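/- Let the state space $\mathcal X$ and the control space $\mathcal U$ be Borel spaces (Borel subsets of Polish spaces), $P_0$ a probability measure on $\mathcal X$, $p\in[1,\infty)$, $1/p+1/q=1$, $\mathcal V=L_p(\mathcal X,P_0)$, and let $\mathcal M$ be the set of probability measures on $\mathcal X$ that have a density in $L_q(\mathcal X,P_0)$ with respect to $P_0$. A risk transition mapping is a measurable $\sigma:\mathcal V\times\mathcal X\times\mathcal M\to\mathbb R$ such that each $\sigma(\cdot,x,m)$ is a coherent measure of risk on $\mathcal V$ (convex, monotone, translation equivariant, positively homogeneous); we assume it is law invariant, that is, $\sigma(\varphi,x,\mu)=\sigma(\psi,x,\nu)$ for all $x$ whenever $\varphi$ under $\mu$ and $\psi$ under $\nu$ have the same distribution function. Consider a controlled Markov model with a control set $U(x)\neq\emptyset$, $x\in\mathcal X$ (a measurable multifunction), a measurable transition kernel $Q(x,u)\in\mathcal M$ for $u\in U(x)$, a cost $c:\mathcal X\times\mathcal U\times\mathcal X\to\mathbb R$, and an absorbing state $x_A$: $Q(\{x_A\}\mid x_A,u)=1$ and $c(x_A,u,x_A)=0$ for $u\in U(x_A)$. Let $\Pi=\{\pi,\pi,\dots\}$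 be a stationary policy with a measurable decision rule $\pi(x)\in U(x)$. Put $\widetilde{\mathcal X}=\mathcal X\setminus\{x_A\}$, let $$\mathcal A(x,m)=\Big\{\mu\in\mathcal M:\ \textstyle\int\varphi\,d\mu\le\sigma(\varphi,x,m)\ \ \forall\varphi\in\mathcal V\Big\},$$ and let $\widetilde{\mathfrak M}^\pi(x)$, $x\in\widetilde{\mathcal X}$, be the set of restrictions to $\widetilde{\mathcal X}$ of the measures in $\mathcal A(x,Q(x,\pi(x)))$. The composition of two set-valued kernels consists, at each point, of the compositions of their measurable selectors, and sums are pointwise Minkowski sums. Let $w:\mathcal X\to[1,\infty)$ be a measurable function in $\mathcal V$, and assume that the model is risk-transient for $\Pi$ with weight $w$: there is a constant $K$ such that for all $T\ge0$ and all measurable selectors $M$ of $\sum_{j=1}^T(\widetilde{\mathfrak M}^\pi)^j$, $$\|M\|_w=\sup_{x\in\widetilde{\mathcal X}}\frac1{w(x)}\int_{\widetilde{\mathcal X}}w(y)\,M(dy\mid x)\le K .$$ Call a function $g$ on $\mathcal X\times\mathcal U\times\mathcal X$ $w$-bounded if $|g(x,u,y)|\le C(w(x)+w(y))$ for some $C$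 and all $x,y\in\mathcal X$, $u\in U(x)$, and a function $v$ on $\mathcal X$ $w$-bounded if $|v|\le Cw$ for some $C$. Assume (G3): $c$ is measurable and $w$-bounded, and $c(\cdot,\cdot,y)$ is lower semicontinuous for every $y$. Let $\rho_t$, $t=1,2,\dots$, be one-step conditional risk measures on the path space of the process started at $x_1$ and controlled by $\Pi$ (each $\rho_t$ maps a vector space of random variables measurable with respect to $\sigma(x_1,\dots,x_{t+1})$ to one of random variables measurable with respect to $\sigma(x_1,\dots,x_t)$, and is convex, monotone, translation equivariant and positively homogeneous almost surely), which form a Markov risk measure with risk transition mapping $\sigma$: for all measurable $w$-bounded $g$, almost surely $$\rho_t\big(g(x_t,\pi(x_t),x_{t+1})\big)=\sigma\big(g(x_t,\pi(x_t),\cdot),x_t,Q(x_t,\pi(x_t))\big).$$ Put $$J_T(\Pi,x_1)=\rho_1\Big(c(x_1,\pi(x_1),x_2)+\rho_2\big(c(x_2,\pi(x_2),x_3)+\cdots+\rho_T(c(x_T,\pi(x_T),x_{T+1}))\cdots\big)\Big).$$ Then the limit $J_\infty(\Pi,x)=\lim_{T\to\infty}J_T(\Pi,x)$ exists and is finite for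 every $x\in\mathcal X$, the function $J_\infty(\Pi,\cdot)$ is $w$-bounded and belongs to $\mathcal V$, and a $w$-bounded function $v\in\mathcal V$ satisfies $$v(x)=\sigma\big(c(x,\pi(x),\cdot)+v(\cdot),x,Q(x,\pi(x))\big),\quad x\in\widetilde{\mathcal X},\qquad v(x_A)=0,$$ if and only if $v(x)=J_\infty(\Pi,x)$ for all $x\in\mathcal X$. -/

import Mathlib

open MeasureTheory ProbabilityTheory Filter Topology
open scoped ENNReal

noncomputable section

namespace RiskMDP

/-! ### The paired spaces `𝒱 = L_p(P₀)` and `𝒱'`, probability measures in `𝒱'` -/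

section Spaces

variable {X : Type*} [MeasurableSpace X]

/-- `m` is a probability measure belonging to the dual `𝒱'` of `𝒱 = L_p(X, P₀)`: it is absolutely
continuous with respect to `P₀`, with a density in `L_q(X, P₀)`. -/
def IsDualProb (P₀ : Measure X) (q : ℝ≥0∞) (m : Measure X) : Prop :=
  IsProbabilityMeasure m ∧ m ≪ P₀ ∧ MemLp (fun y => (m.rnDeriv P₀ y).toReal) q P₀

/-- The set `ℳ` of probability measures in `𝒱'`, with the `σ`-algebra generated by the evaluations
`m ↦ m B`.  (For `p < ∞` and standard Borel `X`, where `L_p` is separable, it is the Borel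
`σ`-algebra of the weak-star topology, both being generated by the maps `m ↦ ∫ φ dm`,
`φ ∈ L_p`.) -/
abbrev DualProb (P₀ : Measure X) (q : ℝ≥0∞) : Type _ := {m : Measure X // IsDualProb P₀ q m}

/-- The element of `𝒱 = L_p(X, P₀)` given by a function `f : X → ℝ` (the value `0` is used when `f`
is not in `L_p`). -/
def toV (p : ℝ≥0∞) (P₀ : Measure X) (f : X → ℝ) : Lp ℝ p P₀ :=
  open Classical in if h : MemLp f p P₀ then h.toLp f else 0

/-- Coherent measures of risk on `𝒱` (axioms A1 - A4). -/
structure IsCoherent {p : ℝ≥0∞} {P₀ : Measure X} [IsFiniteMeasure P₀] (s : Lp ℝ p P₀ → ℝ) :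
    Prop where
  convex : ∀ α : ℝ, 0 < α → α < 1 → ∀ φ ψ : Lp ℝ p P₀,
    s (α • φ + (1 - α) • ψ) ≤ α * s φ + (1 - α) * s ψ
  mono : ∀ φ ψ : Lp ℝ p P₀, φ ≤ ψ → s φ ≤ s ψ
  translation : ∀ (φ : Lp ℝ p P₀) (a : ℝ), s (Lp.const p P₀ a + φ) = a + s φ
  pos_homogeneous : ∀ (φ : Lp ℝ p P₀) (β : ℝ), 0 ≤ β → s (β • φ) = β * s φ

/-- Risk transition mappings `σ : 𝒱 × X × ℳ → ℝ`. The space `𝒱` carries its Borel `σ`-algebra. -/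
structure RiskTransitionMapping (p q : ℝ≥0∞) (P₀ : Measure X) [IsFiniteMeasure P₀]
    [Fact (1 ≤ p)] where
  toFun : Lp ℝ p P₀ → X → DualProb P₀ q → ℝ
  measurable_toFun :
    letI : MeasurableSpace (Lp ℝ p P₀) := borel _
    Measurable fun z : Lp ℝ p P₀ × X × DualProb P₀ q => toFun z.1 z.2.1 z.2.2
  coherent : ∀ (x : X) (m : DualProb P₀ q), IsCoherent fun φ => toFun φ x m

variable {p q : ℝ≥0∞} {P₀ : Measure X} [IsFiniteMeasure P₀] [Fact (1 ≤ p)]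

/-- `σ(f, x, m)` for a function `f : X → ℝ` in `L_p(P₀)`. -/
def RiskTransitionMapping.eval (σ : RiskTransitionMapping p q P₀) (f : X → ℝ) (x : X)
    (m : DualProb P₀ q) : ℝ :=
  σ.toFun (toV p P₀ f) x m

/-- Law invariance: `σ(φ, x, μ)` depends on `φ` and `μ` only through the distribution function of
`φ` under `μ`. -/
def RiskTransitionMapping.LawInvariant (σ : RiskTransitionMapping p q P₀) : Prop :=
  ∀ (φ ψ : Lp ℝ p P₀) (μ ν : DualProb P₀ q),
    (∀ η : ℝ, μ.1 {y | φ y ≤ η} = ν.1 {y | ψ y ≤ η}) →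
      ∀ x : X, σ.toFun φ x μ = σ.toFun ψ x ν

/-- `𝒜(x, m)`: the subdifferential at `0` of the coherent measure of risk `σ(·, x, m)`, a set of
measures in `ℳ`. -/
def RiskTransitionMapping.subdiff (σ : RiskTransitionMapping p q P₀) (x : X)
    (m : DualProb P₀ q) : Set (Measure X) :=
  {μ | IsDualProb P₀ q μ ∧ ∀ φ : Lp ℝ p P₀, ∫ y, φ y ∂μ ≤ σ.toFun φ x m}

end Spaces

/-! ### Multikernels -/

section Multikernels

variable {Y : Type*} [MeasurableSpace Y]

/-- `M ⋖ 𝔐`: the kernel `M` is a measurable selector of the multifunction `𝔐`. -/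
def IsSelector (M : Kernel Y Y) (𝔐 : Y → Set (Measure Y)) : Prop :=
  ∀ x, M x ∈ 𝔐 x

/-- The composition `𝔐₁ 𝔐₂`: at `x`, the measures
`[M₁ M₂](B | x) = ∫ M₂(B | y) M₁(dy | x)` with `M₁ ⋖ 𝔐₁` and `M₂ ⋖ 𝔐₂`. -/
def multiComp (𝔐₁ 𝔐₂ : Y → Set (Measure Y)) : Y → Set (Measure Y) :=
  fun x => {μ | ∃ M₁ M₂ : Kernel Y Y, IsSelector M₁ 𝔐₁ ∧ IsSelector M₂ 𝔐₂ ∧ μ = (M₂ ∘ₖ M₁) x}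

/-- `multiPow 𝔐 n` is the power `(𝔐)^(n+1) = 𝔐 𝔐 ⋯ 𝔐` (`n + 1` factors). -/
def multiPow (𝔐 : Y → Set (Measure Y)) : ℕ → Y → Set (Measure Y)
  | 0 => 𝔐
  | n + 1 => multiComp (multiPow 𝔐 n) 𝔐

/-- The pointwise Minkowski sum of two multikernels. -/
def multiAdd (𝔐₁ 𝔐₂ : Y → Set (Measure Y)) : Y → Set (Measure Y) :=
  fun x => {μ | ∃ μ₁ ∈ 𝔐₁ x, ∃ μ₂ ∈ 𝔐₂ x, μ = μ₁ + μ₂}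

/-- The sum `∑_{j=1}^T (𝔐)^j`. -/
def multiPowSum (𝔐 : Y → Set (Measure Y)) : ℕ → Y → Set (Measure Y)
  | 0 => fun _ => {0}
  | T + 1 => multiAdd (multiPowSum 𝔐 T) (multiPow 𝔐 T)

/-- The operator norm `‖M‖_w = sup_x w(x)⁻¹ ∫ w(y) M(dy | x)`. -/
def kernelNorm (w : Y → ℝ) (M : Kernel Y Y) : ℝ≥0∞ :=
  ⨆ x, (∫⁻ y, ENNReal.ofReal (w y) ∂(M x)) / ENNReal.ofReal (w x)

end Multikernels

/-! ### Controlled Markov models and stationary policies -/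

section Model

variable {X 𝓤 : Type*} [MeasurableSpace X] [TopologicalSpace 𝓤] [MeasurableSpace 𝓤]

/-- A stationary controlled Markov process with an absorbing state `xA`: control set `U` (a
measurable multifunction with nonempty values), controlled transition kernel `Q` on the graph of
`U`, and cost function `c`.  The transition probabilities lie in `𝒱'` (condition G0), so that they
may be inserted in a risk transition mapping. -/
structure ControlledModel (X 𝓤 : Type*) [MeasurableSpace X] [TopologicalSpace 𝓤]
    [MeasurableSpace 𝓤] (P₀ : Measure X) (q : ℝ≥0∞) where
  U : X → Set 𝓤
  U_nonempty : ∀ x, (U x).Nonempty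
  U_measurable : ∀ G : Set 𝓤, IsOpen G → MeasurableSet {x | (U x ∩ G).Nonempty}
  Q : Kernel {z : X × 𝓤 // z.2 ∈ U z.1} X
  Q_dual : ∀ z, IsDualProb P₀ q (Q z)
  c : X → 𝓤 → X → ℝ
  xA : X
  Q_absorbing : ∀ (u : 𝓤) (hu : u ∈ U xA), Q ⟨(xA, u), hu⟩ {xA} = 1
  c_absorbing : ∀ u ∈ U xA, c xA u xA = 0

variable {P₀ : Measure X} {q : ℝ≥0∞}

/-- A (deterministic) stationary Markov policy `{π, π, …}`, given by its measurable feasible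
decision rule `π`. -/
structure StationaryPolicy (𝓜 : ControlledModel X 𝓤 P₀ q) where
  rule : X → 𝓤
  measurable_rule : Measurable rule
  feasible : ∀ x, rule x ∈ 𝓜.U x

/-- The transition kernel `Q^π`, with values `Q(x, π(x))`. -/
def StationaryPolicy.kernel {𝓜 : ControlledModel X 𝓤 P₀ q} (pol : StationaryPolicy 𝓜) :
    Kernel X X :=
  𝓜.Q.comap (fun x => ⟨(x, pol.rule x), pol.feasible x⟩)
    ((measurable_id.prodMk pol.measurable_rule).subtype_mk)

/-- `Q(x, π(x))` as an element of `ℳ`. -/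
def StationaryPolicy.trans {𝓜 : ControlledModel X 𝓤 P₀ q} (pol : StationaryPolicy 𝓜) (x : X) :
    DualProb P₀ q :=
  ⟨pol.kernel x, 𝓜.Q_dual ⟨(x, pol.rule x), pol.feasible x⟩⟩

instance {𝓜 : ControlledModel X 𝓤 P₀ q} (pol : StationaryPolicy 𝓜) : IsMarkovKernel pol.kernel :=
  ⟨fun x => (pol.trans x).2.1⟩

/-- Weight functions `w : X → [1, ∞)`, `w ∈ 𝒱`. -/
structure IsWeight (p : ℝ≥0∞) (P₀ : Measure X) (w : X → ℝ) : Prop where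
  measurable : Measurable w
  one_le : ∀ x, 1 ≤ w x
  memLp : MemLp w p P₀

/-- `w`-boundedness of a function of the state: `|v| ≤ C w` for some constant `C`. -/
def WBounded (w v : X → ℝ) : Prop :=
  ∃ C : ℝ, ∀ x, |v x| ≤ C * w x

/-- `w`-boundedness of a function of a state, a feasible control and a next state. -/
def ControlledModel.CostWBounded (𝓜 : ControlledModel X 𝓤 P₀ q) (w : X → ℝ)
    (g : X → 𝓤 → X → ℝ) : Prop :=
  ∃ C : ℝ, 0 < C ∧ ∀ x, ∀ u ∈ 𝓜.U x, ∀ y, |g x u y| ≤ C * (w x + w y)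

/-- Condition G3: the cost function is measurable, `w`-bounded, and lower semicontinuous in the
state and the control, for every next state. -/
structure ControlledModel.G3 [TopologicalSpace X] (𝓜 : ControlledModel X 𝓤 P₀ q) (w : X → ℝ) :
    Prop where
  measurable : Measurable fun z : X × 𝓤 × X => 𝓜.c z.1 z.2.1 z.2.2
  wBounded : 𝓜.CostWBounded w 𝓜.c
  lsc : ∀ y, LowerSemicontinuous fun z : X × 𝓤 => 𝓜.c z.1 z.2 y

end Model

/-! ### Risk-transient models -/

section Transient

variable {X 𝓤 : Type*} [MeasurableSpace X] [TopologicalSpace 𝓤] [MeasurableSpace 𝓤]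
  {p q : ℝ≥0∞} {P₀ : Measure X} [IsFiniteMeasure P₀] [Fact (1 ≤ p)]

/-- The risk multikernel `𝔐^π(x) = 𝒜(x, Q(x, π(x)))`. -/
def riskMultikernel (σ : RiskTransitionMapping p q P₀) {𝓜 : ControlledModel X 𝓤 P₀ q}
    (pol : StationaryPolicy 𝓜) : X → Set (Measure X) :=
  fun x => σ.subdiff x (pol.trans x)

/-- The effective substochastic multikernel: arguments and measures are restricted to the effective
state space `X ∖ {xA}`. -/
def effMultikernel (σ : RiskTransitionMapping p q P₀) {𝓜 : ControlledModel X 𝓤 P₀ q}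
    (pol : StationaryPolicy 𝓜) : {x // x ≠ 𝓜.xA} → Set (Measure {x // x ≠ 𝓜.xA}) :=
  fun x => (fun μ : Measure X => μ.comap Subtype.val) '' riskMultikernel σ pol x.1

/-- The model is risk-transient for the policy `pol`, with the weight function `w`. -/
def RiskTransient (σ : RiskTransitionMapping p q P₀) {𝓜 : ControlledModel X 𝓤 P₀ q}
    (pol : StationaryPolicy 𝓜) (w : X → ℝ) : Prop :=
  ∃ K : ℝ, ∀ (T : ℕ) (M : Kernel {x // x ≠ 𝓜.xA} {x // x ≠ 𝓜.xA}),
    IsSelector M (multiPowSum (effMultikernel σ pol) T) →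
      kernelNorm (fun x => w x.1) M ≤ ENNReal.ofReal K

end Transient

/-! ### Conditional risk measures and the evaluation of a policy

Times are numbered from `0`: the coordinate `ω t` of a path `ω : ℕ → X` is the state at the
`(t+1)`-st time instant. -/

section Risk

variable {X : Type*} [MeasurableSpace X]

/-- The law on `X^∞` of the Markov chain with transition kernel `κ` and initial state `x₁`. -/
def pathLaw (κ : Kernel X X) [IsMarkovKernel κ] (x₁ : X) : Measure (ℕ → X) :=
  Kernel.traj (X := fun _ => X)
    (fun n => κ.comap (fun h : (Finset.Iic n → X) => h ⟨n, Finset.mem_Iic.2 le_rfl⟩)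
      (measurable_pi_apply _)) 0 (fun _ => x₁)

/-- A family of one-step conditional risk measures `ρ_t : 𝒵_{t+1} → 𝒵_t` on the path space with
law `P`, where `𝒵_t` is a vector space of random variables that are measurable with respect to the
`σ`-algebra generated by the states up to time `t`, and `ρ_t` satisfies A1 - A4, almost surely. -/
structure ConditionalRiskFamily (P : Measure (ℕ → X)) where
  Z : ℕ → Submodule ℝ ((ℕ → X) → ℝ)
  measurable_of_mem : ∀ t, ∀ f ∈ Z t, Measurable[Filtration.piLE (X := fun _ : ℕ => X) t] f
  const_mem : ∀ (t : ℕ) (a : ℝ), (fun _ => a) ∈ Z t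
  ρ : ∀ t : ℕ, Z (t + 1) → Z t
  convex : ∀ (t : ℕ) (α : ℝ), 0 < α → α < 1 → ∀ φ ψ : Z (t + 1),
    (ρ t (α • φ + (1 - α) • ψ)).1 ≤ᵐ[P] (α • ρ t φ + (1 - α) • ρ t ψ).1
  mono : ∀ (t : ℕ) (φ ψ : Z (t + 1)), φ.1 ≤ᵐ[P] ψ.1 → (ρ t φ).1 ≤ᵐ[P] (ρ t ψ).1
  translation : ∀ (t : ℕ) (φ : Z (t + 1)) (a : ℝ),
    (ρ t (⟨fun _ => a, const_mem (t + 1) a⟩ + φ)).1 =ᵐ[P] fun ω => a + (ρ t φ).1 ω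
  pos_homogeneous : ∀ (t : ℕ) (φ : Z (t + 1)) (β : ℝ), 0 ≤ β →
    (ρ t (β • φ)).1 =ᵐ[P] (β • ρ t φ).1

/-- For costs `C t ∈ 𝒵_{t+1}`, the nested risk
`ρ_t (C_t + ρ_{t+1} (C_{t+1} + ⋯ + ρ_{t+n-1} (C_{t+n-1}) ⋯ ))` of the `n` costs from time `t`. -/
def ConditionalRiskFamily.nested {P : Measure (ℕ → X)} (R : ConditionalRiskFamily P)
    (C : ∀ t, R.Z (t + 1)) : ℕ → ∀ t, R.Z t
  | 0, _ => 0
  | n + 1, t => R.ρ t (C t + R.nested C n (t + 1))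

variable {𝓤 : Type*} [TopologicalSpace 𝓤] [MeasurableSpace 𝓤]
  {p q : ℝ≥0∞} {P₀ : Measure X} [IsFiniteMeasure P₀] [Fact (1 ≤ p)]

/-- A Markov risk measure for the controlled process under the stationary policy `pol`, started at
`x₁`, with risk transition mapping `σ`: the spaces `𝒵_{t+1}` contain the variables
`g(x_t, π(x_t), x_{t+1})`, for measurable `w`-bounded `g`, and almost surely
`ρ_t(g(x_t, π(x_t), x_{t+1})) = σ(g(x_t, π(x_t), ·), x_t, Q(x_t, π(x_t)))`. -/
structure MarkovRiskMeasure (σ : RiskTransitionMapping p q P₀) {𝓜 : ControlledModel X 𝓤 P₀ q}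
    (pol : StationaryPolicy 𝓜) (w : X → ℝ) (x₁ : X) extends
    ConditionalRiskFamily (pathLaw pol.kernel x₁) where
  cost_mem : ∀ (g : X → 𝓤 → X → ℝ), Measurable (fun z : X × 𝓤 × X => g z.1 z.2.1 z.2.2) →
    𝓜.CostWBounded w g → ∀ t, (fun ω => g (ω t) (pol.rule (ω t)) (ω (t + 1))) ∈ Z (t + 1)
  markov : ∀ (g : X → 𝓤 → X → ℝ) (hm : Measurable (fun z : X × 𝓤 × X => g z.1 z.2.1 z.2.2))
    (hb : 𝓜.CostWBounded w g) (t : ℕ),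
    (ρ t ⟨fun ω => g (ω t) (pol.rule (ω t)) (ω (t + 1)), cost_mem g hm hb t⟩).1
      =ᵐ[pathLaw pol.kernel x₁]
        fun ω => σ.eval (fun y => g (ω t) (pol.rule (ω t)) y) (ω t) (pol.trans (ω t))

variable [TopologicalSpace X]

/-- The finite horizon cost
`J_T(Π, x₁) = ρ_1(c(x_1, π(x_1), x_2) + ρ_2(c(x_2, π(x_2), x_3) + ⋯ + ρ_T(c(x_T, π(x_T), x_{T+1})) ⋯))`.
The right hand side is a function of the initial state of the path only; it is read off at a path
that starts at `x₁`. -/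
def J {σ : RiskTransitionMapping p q P₀} {𝓜 : ControlledModel X 𝓤 P₀ q}
    {pol : StationaryPolicy 𝓜} {w : X → ℝ} (ρ : ∀ x₁, MarkovRiskMeasure σ pol w x₁)
    (hc : 𝓜.G3 w) (T : ℕ) (x₁ : X) : ℝ :=
  ((ρ x₁).nested
    (fun t => ⟨fun ω => 𝓜.c (ω t) (pol.rule (ω t)) (ω (t + 1)),
      (ρ x₁).cost_mem 𝓜.c hc.measurable hc.wBounded t⟩) T 0).1 fun _ => x₁

/-- The infinite horizon cost `J_∞(Π, x₁) = lim_{T → ∞} J_T(Π, x₁)`. -/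
def Jinf {σ : RiskTransitionMapping p q P₀} {𝓜 : ControlledModel X 𝓤 P₀ q}
    {pol : StationaryPolicy 𝓜} {w : X → ℝ} (ρ : ∀ x₁, MarkovRiskMeasure σ pol w x₁)
    (hc : 𝓜.G3 w) (x₁ : X) : ℝ :=
  limUnder atTop fun T => J ρ hc T x₁

end Risk

end RiskMDP

end

/-!
# Policy evaluation for risk-transient models

Write `S h (x) = σ(h, x, Q(x, π(x)))` (`riskOp`) and `D v (x) = σ(c(x, π(x), ·) + v, x, Q(x, π(x)))`
(`evalOp`). The Markov property of the risk measure and the monotonicity of the conditional risk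
measures give `J_T(Π, x) = D^T 0 (x)` (`J_eq_iterate`), so that the statement is about the iteration
of `D`. Subadditivity of `σ` gives `|D u - D v| ≤ S |u - v|`, hence `|D^n u - D^n v| ≤ S^n |u - v|`
(`IsValue.abs_iterate_sub_le`), and everything follows from the convergence of `∑ S^n h`, with a sum
of order `w`, for measurable `h ≥ 0` of order `w` that vanish at the absorbing state
(`IsTransientBound.exists_sum_le`).

That convergence is where transience enters, and it requires measurable selectors of the risk
multikernel: if for every `φ ∈ L_p` there is a measurable selector `N` with `∫ φ dN(x) = S φ (x)`
for all `x` (`exists_kernel_attaining`), then `S^n h` is the integral of `h` with respect to a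
selector of the `n`-th power of the effective multikernel, and `∑_{n ≤ T} S^n h` is an integral with
respect to a selector of the sum of these powers, whose norm is bounded uniformly in `T`.

The selectors come from a measurable form of the Hahn-Banach theorem. For a sublinear functional `s`
on a separable space, replace `s` by its directional derivative at `φ`, then by the directional
derivative of the result at the first point of a dense sequence, and so on. The decreasing limit
(`lexLimit`) is linear, lies below `s`, agrees with `s` at `φ`, and is obtained from values of `s`
by countably many limits, so that it inherits measurability in a parameter. The functional on `L_p`
obtained in this way is positive, and it is continuous because coherent measures of risk are
automatically bounded (`IsCoherent.exists_bound`). It is therefore given by a probability measure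
with a density in `L_q` (`isDualProb_measureOfCLM`).

The limit of `D^n 0` solves the equation because `σ(·, x, m)` is continuous along dominated
pointwise limits (`RiskTransitionMapping.tendsto_eval`). Law invariance is used only at the absorbing state,
where it makes `σ` the evaluation at `xA`.
-/


noncomputable section

namespace RiskMDP

/-! ### A canonical maximizer in the subdifferential of a sublinear functional -/

section Sublinear

variable {E : Type*} [NormedAddCommGroup E]

/-- Subadditive functionals that are homogeneous with respect to natural multiples.  This weak form
of sublinearity is all that the construction of supporting functionals needs. -/
structure NatSublinear (s : E → ℝ) : Prop where
  add_le : ∀ a b, s (a + b) ≤ s a + s b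
  nsmul : ∀ (n : ℕ) a, s (n • a) = n * s a

lemma NatSublinear.zero {s : E → ℝ} (h : NatSublinear s) : s 0 = 0 := by
  simpa using h.nsmul 0 0

lemma NatSublinear.neg_le {s : E → ℝ} (h : NatSublinear s) (a : E) : -s (-a) ≤ s a := by
  have := h.add_le a (-a)
  rw [add_neg_cancel, h.zero] at this
  linarith

lemma NatSublinear.sub_le {s : E → ℝ} (h : NatSublinear s) (a b : E) :
    s a - s b ≤ s (a - b) := by
  have := h.add_le (a - b) b
  rw [sub_add_cancel] at this
  linarith

/-- The directional derivative of `s` at `a` in the direction `b`, written as the decreasing limit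
of `s (n a + b) - n s a`. It is the support functional of the face of the subdifferential of `s`
on which `a` is maximal. -/
def dirDeriv (s : E → ℝ) (a b : E) : ℝ := ⨅ n : ℕ, (s (n • a + b) - n * s a)

lemma NatSublinear.tendsto_dirDeriv {s : E → ℝ} (h : NatSublinear s) (a b : E) :
    Tendsto (fun n : ℕ => s (n • a + b) - n * s a) atTop (𝓝 (dirDeriv s a b)) := by
  refine tendsto_atTop_ciInf ?_ ⟨-s (-b), ?_⟩
  · refine antitone_nat_of_succ_le fun n => ?_
    have := h.add_le (n • a + b) a
    have e : (n + 1) • a + b = n • a + b + a := by rw [succ_nsmul]; abel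
    rw [e]
    push_cast
    linarith
  · rintro _ ⟨n, rfl⟩
    have := h.add_le (n • a + b) (-b)
    rw [add_neg_cancel_right, h.nsmul] at this
    simp only
    linarith

lemma NatSublinear.dirDeriv_le {s : E → ℝ} (h : NatSublinear s) (a b : E) :
    dirDeriv s a b ≤ s b := by
  refine le_of_tendsto' (h.tendsto_dirDeriv a b) fun n => ?_
  have := h.add_le (n • a) b
  rw [h.nsmul] at this
  linarith

lemma NatSublinear.natSublinear_dirDeriv {s : E → ℝ} (h : NatSublinear s) (a : E) :
    NatSublinear (dirDeriv s a) := by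
  refine ⟨fun b c => ?_, fun k b => ?_⟩
  · have h2 : Tendsto (fun n : ℕ => 2 * n) atTop atTop :=
      tendsto_id.const_mul_atTop' (by norm_num)
    refine le_of_tendsto_of_tendsto' ((h.tendsto_dirDeriv a (b + c)).comp h2)
      ((h.tendsto_dirDeriv a b).add (h.tendsto_dirDeriv a c)) fun n => ?_
    have := h.add_le (n • a + b) (n • a + c)
    have e : (2 * n) • a + (b + c) = n • a + b + (n • a + c) := by rw [two_mul, add_nsmul]; abel
    simp only [Function.comp, e]
    push_cast
    linarith
  · rcases Nat.eq_zero_or_pos k with rfl | hk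
    · have := h.tendsto_dirDeriv a 0
      simp only [add_zero, h.nsmul, sub_self] at this
      simpa using tendsto_nhds_unique this tendsto_const_nhds
    · have h2 : Tendsto (fun n : ℕ => k * n) atTop atTop := tendsto_id.const_mul_atTop' hk
      refine tendsto_nhds_unique ((h.tendsto_dirDeriv a (k • b)).comp h2) ?_
      refine ((h.tendsto_dirDeriv a b).const_mul (k : ℝ)).congr fun n => ?_
      have e : (k * n) • a + k • b = k • (n • a + b) := by rw [nsmul_add, mul_nsmul']
      simp only [Function.comp, e, h.nsmul]
      push_cast
      ring

lemma NatSublinear.dirDeriv_neg_self {s : E → ℝ} (h : NatSublinear s) (a : E) :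
    dirDeriv s a (-a) = -s a := by
  refine tendsto_nhds_unique ((h.tendsto_dirDeriv a (-a)).comp (tendsto_add_atTop_nat 1)) ?_
  refine tendsto_const_nhds.congr fun n => ?_
  simp only [Function.comp, succ_nsmul, add_neg_cancel_right, h.nsmul]
  push_cast
  ring

/-- Successive directional derivatives of `s` at the points `e 0, e 1, …`. -/
def lexSeq (s : E → ℝ) (e : ℕ → E) : ℕ → E → ℝ
  | 0 => s
  | k + 1 => dirDeriv (lexSeq s e k) (e k)

/-- The limit of the successive directional derivatives of `s`: the element of the subdifferential
of `s` that is maximal for the lexicographic order given by the points `e 0, e 1, …`. -/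
def lexLimit (s : E → ℝ) (e : ℕ → E) (b : E) : ℝ := ⨅ k, lexSeq s e k b

lemma NatSublinear.lexSeq {s : E → ℝ} (h : NatSublinear s) (e : ℕ → E) (k : ℕ) :
    NatSublinear (lexSeq s e k) := by
  induction k with
  | zero => exact h
  | succ k ih => exact ih.natSublinear_dirDeriv _

lemma NatSublinear.antitone_lexSeq {s : E → ℝ} (h : NatSublinear s) (e : ℕ → E) (b : E) :
    Antitone fun k => RiskMDP.lexSeq s e k b :=
  antitone_nat_of_succ_le fun k => (h.lexSeq e k).dirDeriv_le _ _

lemma NatSublinear.tendsto_lexLimit {s : E → ℝ} (h : NatSublinear s) (e : ℕ → E) (b : E) :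
    Tendsto (fun k => RiskMDP.lexSeq s e k b) atTop (𝓝 (lexLimit s e b)) := by
  refine tendsto_atTop_ciInf (h.antitone_lexSeq e b) ⟨-s (-b), ?_⟩
  rintro _ ⟨n, rfl⟩
  have h1 := (h.lexSeq e n).neg_le b
  have h2 : RiskMDP.lexSeq s e n (-b) ≤ s (-b) := h.antitone_lexSeq e (-b) (Nat.zero_le n)
  simp only
  linarith

lemma NatSublinear.lexLimit_le_lexSeq {s : E → ℝ} (h : NatSublinear s) (e : ℕ → E) (k : ℕ)
    (b : E) : lexLimit s e b ≤ RiskMDP.lexSeq s e k b :=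
  (h.antitone_lexSeq e b).le_of_tendsto (h.tendsto_lexLimit e b) k

lemma NatSublinear.lexLimit_le {s : E → ℝ} (h : NatSublinear s) (e : ℕ → E) (b : E) :
    lexLimit s e b ≤ s b :=
  h.lexLimit_le_lexSeq e 0 b

lemma NatSublinear.natSublinear_lexLimit {s : E → ℝ} (h : NatSublinear s) (e : ℕ → E) :
    NatSublinear (lexLimit s e) :=
  ⟨fun a b => le_of_tendsto_of_tendsto' (h.tendsto_lexLimit e (a + b))
      ((h.tendsto_lexLimit e a).add (h.tendsto_lexLimit e b)) fun k => (h.lexSeq e k).add_le a b,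
    fun n a => tendsto_nhds_unique (h.tendsto_lexLimit e (n • a))
      (((h.tendsto_lexLimit e a).const_mul (n : ℝ)).congr fun k => ((h.lexSeq e k).nsmul n a).symm)⟩

/-- The first point of the sequence is maximized exactly. -/
lemma NatSublinear.lexLimit_first {s : E → ℝ} (h : NatSublinear s) (e : ℕ → E) :
    lexLimit s e (e 0) = s (e 0) := by
  refine le_antisymm (h.lexLimit_le e _) ?_
  have h1 := (h.natSublinear_lexLimit e).neg_le (e 0)
  have h2 : lexLimit s e (-e 0) ≤ -s (e 0) :=
    (h.lexLimit_le_lexSeq e 1 _).trans_eq (h.dirDeriv_neg_self (e 0))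
  linarith

lemma NatSublinear.lexLimit_neg {s : E → ℝ} (h : NatSublinear s) {C : ℝ}
    (hC : ∀ a, s a ≤ C * ‖a‖) {e : ℕ → E} (he : DenseRange e) (b : E) :
    lexLimit s e (-b) = -lexLimit s e b := by
  have hl := h.natSublinear_lexLimit e
  have hcont : Continuous (lexLimit s e) := by
    refine LipschitzWith.continuous (K := C.toNNReal) (LipschitzWith.of_le_add_mul _ fun a b => ?_)
    have h1 := hl.sub_le a b
    have h2 := (h.lexLimit_le e (a - b)).trans (hC (a - b))
    have h3 : C * ‖a - b‖ ≤ C.toNNReal * dist a b := by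
      rw [dist_eq_norm]
      exact mul_le_mul_of_nonneg_right (Real.le_coe_toNNReal C) (norm_nonneg _)
    linarith
  have key : lexLimit s e (-b) + lexLimit s e b ≤ 0 := by
    refine he.induction_on (p := fun b => lexLimit s e (-b) + lexLimit s e b ≤ 0) b
      (isClosed_le ((hcont.comp continuous_neg).add hcont) continuous_const) fun k => ?_
    have h1 : lexLimit s e (-e k) ≤ -RiskMDP.lexSeq s e k (e k) :=
      (h.lexLimit_le_lexSeq e (k + 1) _).trans_eq ((h.lexSeq e k).dirDeriv_neg_self (e k))
    have h2 := h.lexLimit_le_lexSeq e k (e k)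
    linarith
  have := hl.neg_le b
  linarith

lemma NatSublinear.lexLimit_add {s : E → ℝ} (h : NatSublinear s) {C : ℝ}
    (hC : ∀ a, s a ≤ C * ‖a‖) {e : ℕ → E} (he : DenseRange e) (a b : E) :
    lexLimit s e (a + b) = lexLimit s e a + lexLimit s e b := by
  have hl := h.natSublinear_lexLimit e
  refine le_antisymm (hl.add_le a b) ?_
  have h1 := hl.add_le (a + b) (-b)
  rw [add_neg_cancel_right, h.lexLimit_neg hC he] at h1
  linarith

/-- A bounded sublinear functional on a separable space is supported by the continuous linear
functional `lexLimit s e`, for a dense sequence `e`. -/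
lemma NatSublinear.exists_clm_eq_lexLimit [NormedSpace ℝ E] {s : E → ℝ} (h : NatSublinear s) {C : ℝ}
    (hC : ∀ a, s a ≤ C * ‖a‖) {e : ℕ → E} (he : DenseRange e) :
    ∃ l : E →L[ℝ] ℝ, ∀ a, l a = lexLimit s e a := by
  have hbd : ∀ a, ‖lexLimit s e a‖ ≤ C * ‖a‖ := fun a => by
    have h1 := (h.lexLimit_le e a).trans (hC a)
    have h2 := (h.lexLimit_le e (-a)).trans (hC (-a))
    rw [h.lexLimit_neg hC he, norm_neg] at h2
    exact abs_le.2 ⟨by linarith, h1⟩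
  let f : E →+ ℝ := AddMonoidHom.mk' (lexLimit s e) (h.lexLimit_add hC he)
  exact ⟨f.toRealLinearMap (AddMonoidHomClass.continuous_of_bound f C hbd), fun a => rfl⟩

lemma measurable_lexLimit {X : Type*} [MeasurableSpace X] {s : X → E → ℝ}
    (hs : ∀ a, Measurable fun x => s x a) (e : ℕ → E) (a : E) :
    Measurable fun x => lexLimit (s x) e a := by
  have : ∀ k a, Measurable fun x => lexSeq (s x) e k a := by
    intro k
    induction k with
    | zero => exact hs
    | succ k ih => exact fun a => .iInf fun n => (ih _).sub ((ih _).const_mul _)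
  exact .iInf fun k => this k a

end Sublinear

/-! ### Positive functionals on `L_p` are given by measures with a density in `L_q` -/

section Representation

variable {X : Type*} [MeasurableSpace X] {p q : ℝ≥0∞} {P₀ : Measure X}
  [IsProbabilityMeasure P₀]

variable (p P₀) in
/-- The class in `L_p` of the indicator function of a measurable set. -/
abbrev indLp {B : Set X} (hB : MeasurableSet B) : Lp ℝ p P₀ :=
  indicatorConstLp p hB (measure_ne_top P₀ B) 1

lemma indLp_nonneg {B : Set X} (hB : MeasurableSet B) : 0 ≤ indLp p P₀ hB := by
  rw [← Lp.coeFn_nonneg]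
  filter_upwards [indicatorConstLp_coeFn (p := p) (hs := hB) (hμs := measure_ne_top P₀ B)
    (c := (1 : ℝ))] with x hx
  rw [hx]
  exact Set.indicator_nonneg (fun _ _ => zero_le_one) x

lemma indLp_iUnion_lt {B : ℕ → Set X} (hB : ∀ n, MeasurableSet (B n))
    (hd : Pairwise (Function.onFun Disjoint B)) (n : ℕ) :
    indLp p P₀ (MeasurableSet.iUnion fun i => MeasurableSet.iUnion fun _ : i < n => hB i) =
      ∑ i ∈ Finset.range n, indLp p P₀ (hB i) := by
  induction n with
  | zero => simp
  | succ n ih =>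
    rw [Finset.sum_range_succ, ← ih, ← indicatorConstLp_disjoint_union]
    · congr 1
      simp only [Nat.lt_succ_iff_lt_or_eq, Set.iUnion_or, Set.iUnion_union_distrib,
        Set.iUnion_iUnion_eq_left]
    · simp only [Set.disjoint_iUnion_left]
      exact fun i hi => hd hi.ne

variable [Fact (1 ≤ p)]

lemma hasSum_indLp (hp : p ≠ ∞) {B : ℕ → Set X} (hB : ∀ n, MeasurableSet (B n))
    (hd : Pairwise (Function.onFun Disjoint B)) (l : Lp ℝ p P₀ →L[ℝ] ℝ)
    (hl : ∀ φ, 0 ≤ φ → 0 ≤ l φ) :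
    HasSum (fun n => l (indLp p P₀ (hB n))) (l (indLp p P₀ (MeasurableSet.iUnion hB))) := by
  rw [hasSum_iff_tendsto_nat_of_nonneg fun n => hl _ (indLp_nonneg _)]
  simp_rw [← map_sum, ← indLp_iUnion_lt hB hd]
  refine (l.continuous.tendsto _).comp (tendsto_indicatorConstLp_set hp ?_)
  have h1 : Antitone fun n => (⋃ i, B i) \ ⋃ i, ⋃ (_ : i < n), B i := fun a b hab =>
    Set.sdiff_subset_sdiff_right (Set.iUnion_mono fun i =>
      Set.iUnion_subset fun hi => Set.subset_iUnion_of_subset (hi.trans_le hab) subset_rfl)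
  have h2 := tendsto_measure_iInter_atTop (μ := P₀)
    (fun n => ((MeasurableSet.iUnion hB).diff (MeasurableSet.iUnion fun i =>
      MeasurableSet.iUnion fun _ : i < n => hB i)).nullMeasurableSet) h1
    ⟨0, measure_ne_top _ _⟩
  have h3 : ⋂ n, ((⋃ i, B i) \ ⋃ i, ⋃ (_ : i < n), B i) = ∅ := by
    refine Set.eq_empty_of_forall_notMem fun x hx => ?_
    rw [Set.mem_iInter] at hx
    obtain ⟨i, hi⟩ := Set.mem_iUnion.1 (hx 0).1
    exact (hx (i + 1)).2 (Set.mem_iUnion₂.2 ⟨i, Nat.lt_succ_self i, hi⟩)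
  rw [h3, measure_empty] at h2
  refine h2.congr fun n => ?_
  rw [Set.symmDiff_def]
  have : (⋃ i, ⋃ (_ : i < n), B i) \ ⋃ i, B i = ∅ := by
    rw [Set.sdiff_eq_empty]
    exact Set.iUnion_mono fun i => Set.iUnion_subset fun _ => subset_rfl
  rw [this, Set.empty_union, Function.comp_apply]

/-- The measure `B ↦ l 1_B` given by a positive continuous functional `l` on `L_p`, `p < ∞`. -/
def measureOfCLM (hp : p ≠ ∞) (l : Lp ℝ p P₀ →L[ℝ] ℝ) (hl : ∀ φ, 0 ≤ φ → 0 ≤ l φ) : Measure X :=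
  Measure.ofMeasurable (fun _ hB => ENNReal.ofReal (l (indLp p P₀ hB))) (by simp)
    fun _ hB hd => by
      have h := hasSum_indLp hp hB hd l hl
      rw [← h.tsum_eq, ENNReal.ofReal_tsum_of_nonneg (fun n => hl _ (indLp_nonneg _)) h.summable]

variable (hp : p ≠ ∞) (l : Lp ℝ p P₀ →L[ℝ] ℝ) (hl : ∀ φ, 0 ≤ φ → 0 ≤ l φ)

lemma measureOfCLM_apply {B : Set X} (hB : MeasurableSet B) :
    measureOfCLM hp l hl B = ENNReal.ofReal (l (indLp p P₀ hB)) :=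
  Measure.ofMeasurable_apply B hB

instance : IsFiniteMeasure (measureOfCLM hp l hl) :=
  ⟨by rw [measureOfCLM_apply hp l hl .univ]; exact ENNReal.ofReal_lt_top⟩

lemma measureOfCLM_absolutelyContinuous : measureOfCLM hp l hl ≪ P₀ := by
  refine Measure.AbsolutelyContinuous.mk fun B hB h0 => ?_
  have : indLp p P₀ hB = 0 := by
    rw [← norm_eq_zero, norm_indicatorConstLp (zero_lt_one.trans_le Fact.out).ne' hp]
    have : p.toReal ≠ 0 :=
      (ENNReal.toReal_pos (zero_lt_one.trans_le Fact.out).ne' hp).ne'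
    simp [measureReal_def, h0, this]
  rw [measureOfCLM_apply hp l hl hB, this, map_zero, ENNReal.ofReal_zero]

/-- The measure represents the functional on simple functions. -/
lemma integral_simpleFunc_measureOfCLM (s : SimpleFunc X ℝ) :
    ∃ h : MemLp s p P₀, ∫ x, s x ∂(measureOfCLM hp l hl) = l (h.toLp s) := by
  induction s using SimpleFunc.induction with
  | const c hB =>
    rename_i B
    have e : ⇑(SimpleFunc.piecewise B hB (SimpleFunc.const X c) (SimpleFunc.const X 0)) =
        B.indicator fun _ => c := by
      ext x; simp [Set.indicator, Set.piecewise]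
    have hm : MemLp (B.indicator fun _ => c) p P₀ :=
      memLp_indicator_const p hB c (.inr (measure_ne_top _ _))
    refine ⟨e ▸ hm, ?_⟩
    have e2 : ∀ h, MemLp.toLp (SimpleFunc.piecewise B hB (SimpleFunc.const X c)
        (SimpleFunc.const X 0)) h = c • indLp p P₀ hB := by
      intro h
      refine Lp.ext ?_
      filter_upwards [h.coeFn_toLp, Lp.coeFn_smul c (indLp p P₀ hB),
        indicatorConstLp_coeFn (p := p) (hs := hB) (hμs := measure_ne_top P₀ B)
          (c := (1 : ℝ))] with x h1 h2 h3
      rw [h1, h2, Pi.smul_apply, h3, e]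
      by_cases hx : x ∈ B <;> simp [hx]
    rw [e2, map_smul, e, integral_indicator_const c hB, measureReal_def,
      measureOfCLM_apply hp l hl hB, ENNReal.toReal_ofReal (hl _ (indLp_nonneg _)), smul_eq_mul,
      smul_eq_mul, mul_comm]
  | add _ hf hg =>
    rename_i f g _
    obtain ⟨h1, e1⟩ := hf
    obtain ⟨h2, e2⟩ := hg
    refine ⟨h1.add h2, ?_⟩
    have : MemLp.toLp _ (h1.add h2) = h1.toLp f + h2.toLp g := MemLp.toLp_add h1 h2
    change ∫ x, (f x + g x) ∂_ = l (MemLp.toLp _ (h1.add h2))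
    rw [this, map_add, ← e1, ← e2]
    exact integral_add (SimpleFunc.integrable_of_isFiniteMeasure f)
      (SimpleFunc.integrable_of_isFiniteMeasure g)

/-- Integrals are bounded by the `L_p` norm, here written as an integral so that `g` may be any
measurable function with values in `ℝ≥0∞`. -/
lemma lintegral_measureOfCLM_le (g : X → ℝ≥0∞) (hg : Measurable g) :
    ∫⁻ x, g x ∂(measureOfCLM hp l hl) ≤
      ENNReal.ofReal ‖l‖ * (∫⁻ x, g x ^ p.toReal ∂P₀) ^ (1 / p.toReal) := by
  rw [lintegral_eq_iSup_eapprox_lintegral hg]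
  refine iSup_le fun n => ?_
  let s : SimpleFunc X ℝ := (SimpleFunc.eapprox g n).map ENNReal.toReal
  have hs : ∀ x, ENNReal.ofReal (s x) = SimpleFunc.eapprox g n x := fun x =>
    ENNReal.ofReal_toReal (SimpleFunc.eapprox_lt_top g n x).ne
  have hs0 : ∀ x, 0 ≤ s x := fun x => ENNReal.toReal_nonneg
  obtain ⟨hm, e⟩ := integral_simpleFunc_measureOfCLM hp l hl s
  have h1 : (SimpleFunc.eapprox g n).lintegral (measureOfCLM hp l hl) =
      ENNReal.ofReal (l (hm.toLp s)) := by
    rw [← e, ← SimpleFunc.lintegral_eq_lintegral, ofReal_integral_eq_lintegral_ofReal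
      (SimpleFunc.integrable_of_isFiniteMeasure s) (.of_forall hs0)]
    exact lintegral_congr fun x => (hs x).symm
  have h2 : ENNReal.ofReal ‖hm.toLp s‖ =
      (∫⁻ x, (SimpleFunc.eapprox g n x) ^ p.toReal ∂P₀) ^ (1 / p.toReal) := by
    rw [Lp.norm_toLp, ENNReal.ofReal_toReal hm.2.ne,
      eLpNorm_eq_lintegral_rpow_enorm_toReal (zero_lt_one.trans_le Fact.out).ne' hp]
    simp_rw [Real.enorm_of_nonneg (hs0 _), hs]
  calc _ = ENNReal.ofReal (l (hm.toLp s)) := h1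
    _ ≤ ENNReal.ofReal (‖l‖ * ‖hm.toLp s‖) :=
        ENNReal.ofReal_le_ofReal ((le_abs_self _).trans (l.le_opNorm _))
    _ = ENNReal.ofReal ‖l‖ *
        (∫⁻ x, (SimpleFunc.eapprox g n x) ^ p.toReal ∂P₀) ^ (1 / p.toReal) := by
        rw [ENNReal.ofReal_mul (norm_nonneg _), h2]
    _ ≤ _ := by
        gcongr with x
        exact (le_iSup (fun n => SimpleFunc.eapprox g n x) n).trans_eq
          (SimpleFunc.iSup_eapprox_apply hg x)

lemma integrable_measureOfCLM (φ : Lp ℝ p P₀) : Integrable φ (measureOfCLM hp l hl) := by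
  refine ⟨(Lp.aestronglyMeasurable φ).mono_ac (measureOfCLM_absolutelyContinuous hp l hl), ?_⟩
  have hm := (Lp.stronglyMeasurable φ).measurable
  refine (lintegral_measureOfCLM_le hp l hl _ hm.enorm).trans_lt ?_
  rw [← eLpNorm_eq_lintegral_rpow_enorm_toReal (zero_lt_one.trans_le Fact.out).ne' hp]
  exact ENNReal.mul_lt_top ENNReal.ofReal_lt_top (Lp.eLpNorm_lt_top φ)

/-- The measure represents the functional on all of `L_p`: both sides are continuous, by
`lintegral_measureOfCLM_le`. -/
lemma integral_measureOfCLM (φ : Lp ℝ p P₀) : ∫ x, φ x ∂(measureOfCLM hp l hl) = l φ := by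
  have hac := measureOfCLM_absolutelyContinuous hp l hl
  have hsub : ∀ φ ψ : Lp ℝ p P₀, ∫ x, (φ - ψ) x ∂(measureOfCLM hp l hl) =
      ∫ x, φ x ∂(measureOfCLM hp l hl) - ∫ x, ψ x ∂(measureOfCLM hp l hl) := fun φ ψ => by
    rw [← integral_sub (integrable_measureOfCLM hp l hl φ) (integrable_measureOfCLM hp l hl ψ)]
    exact integral_congr_ae (hac.ae_eq (Lp.coeFn_sub φ ψ))
  have hbd : ∀ φ : Lp ℝ p P₀, ‖∫ x, φ x ∂(measureOfCLM hp l hl)‖ ≤ ‖l‖ * ‖φ‖ := fun φ => by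
    refine (norm_integral_le_lintegral_norm _).trans ?_
    have h := lintegral_measureOfCLM_le hp l hl _ (Lp.stronglyMeasurable φ).measurable.enorm
    rw [← eLpNorm_eq_lintegral_rpow_enorm_toReal (zero_lt_one.trans_le Fact.out).ne' hp] at h
    simp_rw [ofReal_norm]
    refine (ENNReal.toReal_mono
      (ENNReal.mul_ne_top ENNReal.ofReal_ne_top (Lp.eLpNorm_ne_top φ)) h).trans_eq ?_
    rw [ENNReal.toReal_mul, ENNReal.toReal_ofReal (norm_nonneg _), Lp.norm_def]
  have hcont : Continuous fun φ : Lp ℝ p P₀ => ∫ x, φ x ∂(measureOfCLM hp l hl) := by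
    refine LipschitzWith.continuous (K := ‖l‖.toNNReal) (LipschitzWith.of_dist_le_mul fun φ ψ => ?_)
    rw [dist_eq_norm, dist_eq_norm, ← hsub, Real.coe_toNNReal _ (norm_nonneg _)]
    exact hbd _
  refine Lp.induction hp (motive := fun φ => ∫ x, φ x ∂(measureOfCLM hp l hl) = l φ) ?_ ?_ ?_ φ
  · intro c B hB hB'
    obtain ⟨h, e⟩ := integral_simpleFunc_measureOfCLM hp l hl
      (SimpleFunc.piecewise B hB (SimpleFunc.const X c) (SimpleFunc.const X 0))
    have e2 : ⇑(SimpleFunc.piecewise B hB (SimpleFunc.const X c) (SimpleFunc.const X 0)) =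
        B.indicator fun _ => c := by
      ext x; simp [Set.indicator, Set.piecewise]
    have e3 : (Lp.simpleFunc.indicatorConst p hB hB'.ne c : Lp ℝ p P₀) = h.toLp _ := by
      rw [Lp.simpleFunc.coe_indicatorConst]
      refine Lp.ext ?_
      filter_upwards [h.coeFn_toLp, indicatorConstLp_coeFn (p := p) (hs := hB)
        (hμs := hB'.ne) (c := c)] with x h1 h2
      rw [h1, h2, e2]
    rw [e3, ← e]
    exact integral_congr_ae (hac.ae_eq h.coeFn_toLp)
  · intro f g hf hg _ h1 h2
    rw [map_add, ← h1, ← h2, ← integral_add (integrable_measureOfCLM hp l hl _)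
      (integrable_measureOfCLM hp l hl _)]
    exact integral_congr_ae (hac.ae_eq (Lp.coeFn_add _ _))
  · exact isClosed_eq hcont l.continuous

/-- The converse of Hölder's inequality: a density that pairs boundedly with `L_p` lies in `L_q`.
For `p > 1` the bound is tested at `g = min(f, n)^(q - 1)`; for `p = 1` it is tested at
indicators. -/
lemma memLp_of_forall_lintegral_mul_le (hp : p ≠ ∞) (hpq : ENNReal.HolderConjugate p q)
    {f : X → ℝ≥0∞} (hf : Measurable f) {C : ℝ≥0∞} (hC : C ≠ ∞)
    (h : ∀ g : X → ℝ≥0∞, Measurable g →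
      ∫⁻ x, f x * g x ∂P₀ ≤ C * (∫⁻ x, g x ^ p.toReal ∂P₀) ^ (1 / p.toReal)) :
    MemLp (fun x => (f x).toReal) q P₀ := by
  have hp1 : 1 ≤ p := Fact.out
  refine ⟨hf.ennreal_toReal.aestronglyMeasurable, ?_⟩
  have hle : ∀ x, ‖(f x).toReal‖ₑ ≤ f x := fun x => by
    rw [Real.enorm_of_nonneg ENNReal.toReal_nonneg]
    exact ENNReal.ofReal_toReal_le
  rcases hp1.eq_or_lt with rfl | hp1'
  · have hq : q = ∞ := ENNReal.HolderConjugate.unique 1 q ∞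
    rw [hq, eLpNorm_exponent_top]
    have : f ≤ᵐ[P₀] fun _ => C := by
      refine ae_le_of_forall_setLIntegral_le_of_sigmaFinite hf fun B hB _ => ?_
      have := h (B.indicator 1) (measurable_one.indicator hB)
      have e1 : ∀ x, f x * B.indicator 1 x = B.indicator f x := fun x => by
        by_cases hx : x ∈ B <;> simp [hx]
      simp only [e1, lintegral_indicator hB, ENNReal.toReal_one, ENNReal.rpow_one, div_one,
        Pi.one_apply, lintegral_const, one_mul] at this ⊢
      exact this
    refine (essSup_le_of_ae_le C ?_).trans_lt hC.lt_top
    filter_upwards [this] with x hx using (hle x).trans hx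
  · have hq1 : 1 ≤ q := ENNReal.HolderConjugate.one_le q p
    have hqt : q ≠ ∞ := by
      rintro rfl
      have := hpq.symm
      exact hp1'.ne (ENNReal.HolderConjugate.unique ∞ 1 p)
    have hr : p.toReal.HolderConjugate q.toReal := ENNReal.HolderConjugate.toReal_of_ne_top hp hqt
    rw [eLpNorm_lt_top_iff_lintegral_rpow_enorm_lt_top (zero_lt_one.trans_le hq1).ne' hqt]
    -- The truncation makes the integral finite, so that it may be cancelled below.
    have key : ∀ n : ℕ, ∫⁻ x, (min (f x) n) ^ q.toReal ∂P₀ ≤ C ^ q.toReal := fun n => by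
      set I := ∫⁻ x, (min (f x) n) ^ q.toReal ∂P₀ with hI
      have hIt : I ≠ ∞ := by
        refine ((lintegral_mono (g := fun _ => (n : ℝ≥0∞) ^ q.toReal) fun x => ?_).trans_lt ?_).ne
        · exact ENNReal.rpow_le_rpow (min_le_right _ _) ENNReal.toReal_nonneg
        · simp [ENNReal.rpow_lt_top_of_nonneg ENNReal.toReal_nonneg]
      rcases eq_or_ne I 0 with h0 | h0
      · rw [h0]; exact zero_le
      have h1 : I ≤ C * I ^ (1 / p.toReal) := by
        have h2 := h (fun x => (min (f x) n) ^ (q.toReal - 1))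
          ((hf.min measurable_const).pow_const _)
        have e1 : ∀ x, ((min (f x) (n : ℝ≥0∞)) ^ (q.toReal - 1)) ^ p.toReal =
            (min (f x) n) ^ q.toReal := fun x => by
          rw [← ENNReal.rpow_mul, hr.symm.sub_one_mul_conj]
        simp only [e1] at h2
        refine le_trans (lintegral_mono fun x => ?_) h2
        have : (min (f x) (n : ℝ≥0∞)) ^ q.toReal =
            min (f x) n * (min (f x) n) ^ (q.toReal - 1) := by
          conv_rhs => rw [← ENNReal.rpow_one (min (f x) (n : ℝ≥0∞)), ← ENNReal.rpow_mul, one_mul]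
          rw [← ENNReal.rpow_add_of_nonneg _ _ zero_le_one hr.symm.sub_one_pos.le]
          congr 1; ring
        simp only
        rw [this]
        gcongr
        exact min_le_left _ _
      have h3 : I ^ (1 / q.toReal) ≤ C := by
        have e2 : I = I ^ (1 / q.toReal) * I ^ (1 / p.toReal) := by
          rw [← ENNReal.rpow_add _ _ h0 hIt, one_div, one_div, hr.symm.inv_add_inv_eq_one,
            ENNReal.rpow_one]
        have h4 : I ^ (1 / q.toReal) * I ^ (1 / p.toReal) ≤ C * I ^ (1 / p.toReal) := e2 ▸ h1
        exact (ENNReal.mul_le_mul_iff_left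
          (ENNReal.rpow_pos (pos_iff_ne_zero.2 h0) hIt).ne'
          (ENNReal.rpow_ne_top_of_nonneg (by positivity) hIt)).1 h4
      have := ENNReal.rpow_le_rpow h3 (z := q.toReal) ENNReal.toReal_nonneg
      rwa [← ENNReal.rpow_mul, one_div, inv_mul_cancel₀ hr.symm.ne_zero, ENNReal.rpow_one] at this
    have hmono : ∫⁻ x, f x ^ q.toReal ∂P₀ ≤ C ^ q.toReal := by
      have e : ∀ x, f x ^ q.toReal = ⨆ n : ℕ, (min (f x) n) ^ q.toReal := fun x => by
        have h4 : Tendsto (fun n : ℕ => (min (f x) (n : ℝ≥0∞)) ^ q.toReal) atTop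
            (𝓝 (f x ^ q.toReal)) := by
          have h5 := (tendsto_const_nhds (x := f x) (f := atTop)).min ENNReal.tendsto_nat_nhds_top
          rw [min_top_right] at h5
          exact (ENNReal.continuous_rpow_const.tendsto _).comp h5
        exact tendsto_nhds_unique h4 (tendsto_atTop_iSup fun a b hab =>
          ENNReal.rpow_le_rpow (min_le_min le_rfl (Nat.cast_le.2 hab)) ENNReal.toReal_nonneg)
      simp_rw [e]
      rw [lintegral_iSup (fun n => (hf.min measurable_const).pow_const _)
        (fun a b hab x => by dsimp only; gcongr)]
      exact iSup_le key
    refine ((lintegral_mono fun x => ?_).trans hmono).trans_lt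
      (ENNReal.rpow_lt_top_of_nonneg ENNReal.toReal_nonneg hC)
    exact ENNReal.rpow_le_rpow (hle x) ENNReal.toReal_nonneg

lemma isDualProb_measureOfCLM (hpq : ENNReal.HolderConjugate p q)
    (h1 : l (Lp.const p P₀ 1) = 1) : IsDualProb P₀ q (measureOfCLM hp l hl) := by
  have hac := measureOfCLM_absolutelyContinuous hp l hl
  refine ⟨⟨?_⟩, hac, ?_⟩
  · have : indLp p P₀ MeasurableSet.univ = Lp.const p P₀ 1 := indicatorConstLp_univ p P₀ 1
    rw [measureOfCLM_apply hp l hl .univ, this, h1, ENNReal.ofReal_one]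
  · refine memLp_of_forall_lintegral_mul_le hp hpq (Measure.measurable_rnDeriv _ _)
      (C := ENNReal.ofReal ‖l‖) ENNReal.ofReal_ne_top fun g hg => ?_
    rw [lintegral_rnDeriv_mul hac hg.aemeasurable]
    exact lintegral_measureOfCLM_le hp l hl g hg

end Representation

/-! ### Coherent measures of risk on `L_p` -/

section Coherent

variable {X : Type*} [MeasurableSpace X] {p : ℝ≥0∞} {P₀ : Measure X}
  [IsFiniteMeasure P₀] {s : Lp ℝ p P₀ → ℝ}

lemma IsCoherent.add_le (h : IsCoherent s) (φ ψ : Lp ℝ p P₀) : s (φ + ψ) ≤ s φ + s ψ := by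
  have h1 := h.convex (1 / 2) (by norm_num) (by norm_num) ((2 : ℝ) • φ) ((2 : ℝ) • ψ)
  have e : (1 / 2 : ℝ) • (2 : ℝ) • φ + (1 - 1 / 2 : ℝ) • (2 : ℝ) • ψ = φ + ψ := by
    rw [smul_smul, smul_smul]
    norm_num
  rw [e, h.pos_homogeneous _ 2 zero_le_two, h.pos_homogeneous _ 2 zero_le_two] at h1
  linarith

variable [Fact (1 ≤ p)]

lemma IsCoherent.natSublinear (h : IsCoherent s) : NatSublinear s :=
  ⟨h.add_le, fun n φ => by rw [← Nat.cast_smul_eq_nsmul ℝ, h.pos_homogeneous _ _ n.cast_nonneg]⟩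

lemma IsCoherent.const (h : IsCoherent s) (a : ℝ) : s (Lp.const p P₀ a) = a := by
  have := h.translation 0 a
  rwa [add_zero, h.natSublinear.zero, add_zero] at this

/-- A coherent measure of risk is automatically bounded: otherwise there would be nonnegative
`ψ_n` with `‖ψ_n‖ = 2⁻ⁿ` and `s ψ_n > 2ⁿ`, and then `s` would be infinite at `∑ ψ_n`, by
monotonicity. -/
lemma IsCoherent.exists_bound (h : IsCoherent s) :
    ∃ C : ℝ, ∀ φ, s φ ≤ C * ‖φ‖ := by
  by_contra! hcon
  choose f hf using fun n : ℕ => hcon (4 ^ n)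
  have hpos : ∀ n, 0 < ‖f n‖ := fun n => by
    refine norm_pos_iff.2 fun h0 => ?_
    have := hf n
    rw [h0, h.natSublinear.zero, norm_zero, mul_zero] at this
    exact lt_irrefl _ this
  let g : ℕ → Lp ℝ p P₀ := fun n => (1 / (2 ^ n * ‖f n‖)) • |f n|
  have hc : ∀ n, 0 < 1 / (2 ^ n * ‖f n‖) := fun n => by have := hpos n; positivity
  have hg0 : ∀ n, 0 ≤ g n := fun n => by
    have h1 : 0 ≤ |f n| := abs_nonneg _
    rw [← Lp.coeFn_nonneg] at h1 ⊢
    filter_upwards [h1, Lp.coeFn_smul (1 / (2 ^ n * ‖f n‖)) |f n|] with x hx1 hx2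
    rw [hx2]
    exact mul_nonneg (hc n).le hx1
  have hgn : ∀ n, ‖g n‖ = (1 / 2) ^ n := fun n => by
    rw [norm_smul, norm_abs_eq_norm, Real.norm_of_nonneg (hc n).le]
    have := (hpos n).ne'
    rw [one_div, one_div, mul_inv, inv_mul_cancel_right₀ this, inv_pow]
  have hsum : Summable g := by
    refine Summable.of_norm ?_
    simp_rw [hgn]
    exact summable_geometric_two
  have hle : ∀ n, (2 : ℝ) ^ n ≤ s (∑' k, g k) := fun n => by
    have h1 : s (g n) ≤ s (∑' k, g k) :=
      h.mono _ _ (le_hasSum hsum.hasSum n fun j _ => hg0 j)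
    have h2 : s (f n) ≤ s |f n| := h.mono _ _ (le_abs_self _)
    have h3 : s (g n) = (1 / (2 ^ n * ‖f n‖)) * s |f n| := h.pos_homogeneous _ _ (hc n).le
    have h4 : (1 / (2 ^ n * ‖f n‖)) * (4 ^ n * ‖f n‖) ≤ s (g n) := by
      rw [h3]
      exact mul_le_mul_of_nonneg_left ((hf n).le.trans h2) (hc n).le
    have h5 : (1 / (2 ^ n * ‖f n‖)) * (4 ^ n * ‖f n‖) = 2 ^ n := by
      have := (hpos n).ne'
      have e : (4 : ℝ) ^ n = 2 ^ n * 2 ^ n := by rw [← mul_pow]; norm_num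
      rw [e]
      field_simp
    linarith
  obtain ⟨n, hn⟩ := pow_unbounded_of_one_lt (s (∑' k, g k)) (one_lt_two (α := ℝ))
  exact absurd (hle n) (not_le.2 hn)

end Coherent

/-! ### Risk transition mappings as functionals of functions -/

section Eval

variable {X : Type*} [MeasurableSpace X] {p q : ℝ≥0∞} {P₀ : Measure X}

lemma toV_of_memLp {f : X → ℝ} (hf : MemLp f p P₀) : toV p P₀ f = hf.toLp f := dif_pos hf

lemma toV_congr {f g : X → ℝ} (h : f =ᵐ[P₀] g) : toV p P₀ f = toV p P₀ g := by
  by_cases hf : MemLp f p P₀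
  · rw [toV_of_memLp hf, toV_of_memLp ((memLp_congr_ae h).1 hf)]
    exact MemLp.toLp_congr _ _ h
  · have hg : ¬MemLp g p P₀ := fun hg => hf ((memLp_congr_ae h).2 hg)
    rw [toV, toV, dif_neg hf, dif_neg hg]

namespace RiskTransitionMapping

variable [IsFiniteMeasure P₀] [Fact (1 ≤ p)] (σ : RiskTransitionMapping p q P₀)
  {f g : X → ℝ} (x : X) (m : DualProb P₀ q)

lemma eval_mono (hf : MemLp f p P₀) (hg : MemLp g p P₀) (h : ∀ y, f y ≤ g y) :
    σ.eval f x m ≤ σ.eval g x m := by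
  rw [eval, eval, toV_of_memLp hf, toV_of_memLp hg]
  refine (σ.coherent x m).mono _ _ ?_
  rw [← Lp.coeFn_le]
  filter_upwards [hf.coeFn_toLp, hg.coeFn_toLp] with y h1 h2
  rw [h1, h2]
  exact h y

lemma eval_add_le (hf : MemLp f p P₀) (hg : MemLp g p P₀) :
    σ.eval (fun y => f y + g y) x m ≤ σ.eval f x m + σ.eval g x m := by
  have : toV p P₀ (fun y => f y + g y) = toV p P₀ f + toV p P₀ g := by
    rw [toV_of_memLp hf, toV_of_memLp hg, ← MemLp.toLp_add hf hg]
    exact toV_of_memLp (hf.add hg)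
  rw [eval, this]
  exact (σ.coherent x m).add_le _ _

lemma eval_const_mul (hf : MemLp f p P₀) {β : ℝ} (hβ : 0 ≤ β) :
    σ.eval (fun y => β * f y) x m = β * σ.eval f x m := by
  have : toV p P₀ (fun y => β * f y) = β • toV p P₀ f := by
    rw [toV_of_memLp hf, ← MemLp.toLp_const_smul β hf]
    exact toV_of_memLp (hf.const_smul β)
  rw [eval, this]
  exact (σ.coherent x m).pos_homogeneous _ _ hβ

lemma eval_const (a : ℝ) : σ.eval (fun _ => a) x m = a := by
  rw [eval, toV_of_memLp (memLp_const a)]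
  exact (σ.coherent x m).const a

lemma eval_sub_le (hf : MemLp f p P₀) (hg : MemLp g p P₀) :
    σ.eval f x m - σ.eval g x m ≤ σ.eval (fun y => f y - g y) x m := by
  have := σ.eval_add_le x m (hf.sub hg) hg
  simp only [Pi.sub_apply, sub_add_cancel] at this
  linarith! [this]

lemma abs_eval_sub_le (hf : MemLp f p P₀) (hg : MemLp g p P₀) :
    |σ.eval f x m - σ.eval g x m| ≤ σ.eval (fun y => |f y - g y|) x m := by
  have hd : MemLp (fun y => |f y - g y|) p P₀ := (hf.sub hg).abs
  refine abs_sub_le_iff.2 ⟨(σ.eval_sub_le x m hf hg).trans ?_,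
    (σ.eval_sub_le x m hg hf).trans ?_⟩
  · exact σ.eval_mono x m (hf.sub hg) hd fun y => le_abs_self _
  · exact σ.eval_mono x m (hg.sub hf) hd fun y => abs_sub_comm (f y) (g y) ▸ le_abs_self _

/-- Continuity of `σ(·, x, m)` under dominated pointwise convergence. -/
lemma tendsto_eval (hp : p ≠ ∞) {F : ℕ → X → ℝ} {G : X → ℝ} (hF : ∀ n, MemLp (F n) p P₀)
    (hf : MemLp f p P₀) (hG : MemLp G p P₀) (hle : ∀ n y, |F n y - f y| ≤ G y)
    (hlim : ∀ y, Tendsto (fun n => F n y) atTop (𝓝 (f y))) :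
    Tendsto (fun n => σ.eval (F n) x m) atTop (𝓝 (σ.eval f x m)) := by
  have hp0 : p ≠ 0 := (zero_lt_one.trans_le Fact.out).ne'
  have hpr : 0 < p.toReal := ENNReal.toReal_pos hp0 hp
  have h0 : Tendsto (fun n => eLpNorm (F n - f) p P₀) atTop (𝓝 0) := by
    have h1 : Tendsto (fun n => ∫⁻ y, ‖(F n - f) y‖ₑ ^ p.toReal ∂P₀) atTop (𝓝 0) := by
      have h2 := tendsto_lintegral_of_dominated_convergence' (μ := P₀)
        (F := fun n y => ‖(F n - f) y‖ₑ ^ p.toReal) (f := fun _ => 0)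
        (fun y => ‖G y‖ₑ ^ p.toReal)
        (fun n => ((hF n).sub hf).1.enorm.pow_const _)
        (fun n => .of_forall fun y => ENNReal.rpow_le_rpow
          (by
            rw [Real.enorm_eq_ofReal_abs, Real.enorm_eq_ofReal_abs]
            exact ENNReal.ofReal_le_ofReal ((hle n y).trans (le_abs_self _))) hpr.le)
        (eLpNorm_lt_top_iff_lintegral_rpow_enorm_lt_top hp0 hp |>.1 hG.2).ne
        (.of_forall fun y => ?_)
      · simpa using h2
      · have h3 : Tendsto (fun n => F n y - f y) atTop (𝓝 0) := by
          simpa using (hlim y).sub_const (f y)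
        have h4 := (ENNReal.continuous_rpow_const (y := p.toReal)).tendsto 0 |>.comp
          (by simpa using h3.enorm)
        simpa [Function.comp_def, ENNReal.zero_rpow_of_pos hpr] using h4
    simp_rw [eLpNorm_eq_lintegral_rpow_enorm_toReal hp0 hp]
    have h5 := (ENNReal.continuous_rpow_const (y := 1 / p.toReal)).tendsto 0 |>.comp h1
    rwa [ENNReal.zero_rpow_of_pos (by positivity)] at h5
  obtain ⟨C, hC⟩ := (σ.coherent x m).exists_bound
  have h6 : Tendsto (fun n => C * ‖(hF n).toLp (F n) - hf.toLp f‖) atTop (𝓝 0) := by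
    have h7 : Tendsto (fun n => ‖(hF n).toLp (F n) - hf.toLp f‖) atTop (𝓝 0) := by
      have h8 := (ENNReal.continuousAt_toReal ENNReal.zero_ne_top).tendsto.comp h0
      rw [ENNReal.toReal_zero] at h8
      refine h8.congr fun n => ?_
      rw [← MemLp.toLp_sub, Lp.norm_toLp, Function.comp_apply]
    simpa using h7.const_mul C
  rw [tendsto_iff_norm_sub_tendsto_zero]
  refine squeeze_zero (fun n => norm_nonneg _) (fun n => ?_) h6
  have hs := (σ.coherent x m).natSublinear
  simp only [eval, toV_of_memLp hf, toV_of_memLp (hF n), Real.norm_eq_abs]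
  refine abs_sub_le_iff.2 ⟨(hs.sub_le _ _).trans (hC _), ?_⟩
  rw [norm_sub_rev]
  exact (hs.sub_le _ _).trans (hC _)

/-- A law invariant risk transition mapping reduces to the evaluation at `a` if the next state is
`a` with probability one. -/
lemma eval_of_singleton (hσ : σ.LawInvariant) [MeasurableSingletonClass X] {a : X}
    (hm : m.1 {a} = 1) (hf : MemLp f p P₀) : σ.eval f x m = f a := by
  have : IsProbabilityMeasure m.1 := m.2.1
  have hae : ∀ᵐ y ∂m.1, y = a := by
    rw [← prob_compl_eq_zero_iff (measurableSet_singleton a)] at hm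
    exact hm
  have h1 : toV p P₀ f =ᵐ[m.1] fun _ => f a := by
    rw [toV_of_memLp hf]
    filter_upwards [m.2.2.1.ae_eq hf.coeFn_toLp, hae] with y hy1 hy2
    rw [hy1, hy2]
  have h2 : Lp.const p P₀ (f a) =ᵐ[m.1] fun _ => f a := m.2.2.1.ae_eq (Lp.coeFn_const ..)
  have h3 := hσ (toV p P₀ f) (Lp.const p P₀ (f a)) m m (fun η => measure_congr ?_) x
  · rw [eval, h3]
    exact (σ.coherent x m).const _
  · filter_upwards [h1, h2] with y hy1 hy2
    change (_ ≤ η) = (_ ≤ η)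
    rw [hy1, hy2]

end RiskTransitionMapping

end Eval

/-! ### Measurability in `L_p` -/

section Measurability

/-- In a second countable space the open balls generate the Borel `σ`-algebra. -/
lemma measurable_of_measurable_dist {X E : Type*} [MeasurableSpace X] [PseudoMetricSpace E]
    [SecondCountableTopology E] [MeasurableSpace E] [BorelSpace E] {Φ : X → E}
    (h : ∀ e, Measurable fun x => dist (Φ x) e) : Measurable Φ := by
  refine measurable_of_isOpen fun O hO => ?_
  choose! r hr0 hr using fun y (hy : y ∈ O) => Metric.isOpen_iff.1 hO y hy
  obtain ⟨T, hT, e⟩ := TopologicalSpace.isOpen_iUnion_countable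
    (fun y : O => Metric.ball (y : E) (r y)) fun _ => Metric.isOpen_ball
  have hO' : O = ⋃ y ∈ T, Metric.ball (y : E) (r y) := by
    rw [e]
    refine Set.Subset.antisymm (fun y hy => ?_) (Set.iUnion_subset fun y => hr y y.2)
    exact Set.mem_iUnion.2 ⟨⟨y, hy⟩, Metric.mem_ball_self (hr0 y hy)⟩
  rw [hO', Set.preimage_iUnion₂]
  exact .biUnion hT fun y _ => h y measurableSet_Iio

variable {X Y : Type*} [MeasurableSpace X] [MeasurableSpace Y]
  [MeasurableSpace.CountablyGenerated Y] {p : ℝ≥0∞} {P₀ : Measure Y} [IsFiniteMeasure P₀] [Fact (1 ≤ p)]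

/-- A jointly measurable function with sections in `L_p` is a Borel map into `L_p`, as the distances
to fixed elements of `L_p` are measurable by Tonelli's theorem. -/
lemma measurable_toV (hp : p ≠ ∞) {f : X → Y → ℝ} (hf : Measurable fun z : X × Y => f z.1 z.2)
    (hm : ∀ x, MemLp (f x) p P₀) : Measurable[_, borel (Lp ℝ p P₀)] fun x => toV p P₀ (f x) := by
  have hp0 : p ≠ 0 := (zero_lt_one.trans_le Fact.out).ne'
  have : Fact (p ≠ ∞) := ⟨hp⟩
  let _ : MeasurableSpace (Lp ℝ p P₀) := borel _
  have : BorelSpace (Lp ℝ p P₀) := ⟨rfl⟩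
  refine measurable_of_measurable_dist fun ψ => ?_
  have hψ := (Lp.stronglyMeasurable ψ).measurable
  have e : ∀ x, dist (toV p P₀ (f x)) ψ =
      ((∫⁻ y, ‖f x y - ψ y‖ₑ ^ p.toReal ∂P₀) ^ (1 / p.toReal)).toReal := fun x => by
    rw [toV_of_memLp (hm x), Lp.dist_def, eLpNorm_eq_lintegral_rpow_enorm_toReal hp0 hp]
    congr 2
    refine lintegral_congr_ae ?_
    filter_upwards [(hm x).coeFn_toLp] with y hy
    rw [Pi.sub_apply, hy]
  simp_rw [e]
  refine (Measurable.pow_const (Measurable.lintegral_prod_right'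
    (f := fun z : X × Y => ‖f z.1 z.2 - ψ z.2‖ₑ ^ p.toReal) ?_) _).ennreal_toReal
  exact (hf.sub (hψ.comp measurable_snd)).enorm.pow_const _

end Measurability

/-! ### Measurable maximizing selectors of the risk multikernel -/

section Selectors

variable {X 𝓤 : Type*} [MeasurableSpace X] [TopologicalSpace 𝓤] [MeasurableSpace 𝓤]
  {p q : ℝ≥0∞} {P₀ : Measure X} {𝓜 : ControlledModel X 𝓤 P₀ q} (pol : StationaryPolicy 𝓜)

lemma StationaryPolicy.measurable_trans : Measurable pol.trans :=
  (Kernel.measurable pol.kernel).subtype_mk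

variable [IsProbabilityMeasure P₀] [Fact (1 ≤ p)] (σ : RiskTransitionMapping p q P₀)

lemma RiskTransitionMapping.measurable_trans {Φ : X → Lp ℝ p P₀}
    (hΦ : Measurable[_, borel (Lp ℝ p P₀)] Φ) :
    Measurable fun x => σ.toFun (Φ x) x (pol.trans x) := by
  let _ : MeasurableSpace (Lp ℝ p P₀) := borel _
  have : BorelSpace (Lp ℝ p P₀) := ⟨rfl⟩
  exact σ.measurable_toFun.comp (hΦ.prodMk (measurable_id.prodMk pol.measurable_trans))

lemma RiskTransitionMapping.measurable_eval_trans [MeasurableSpace.CountablyGenerated X]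
    (hp : p ≠ ∞) {f : X → X → ℝ}
    (hf : Measurable fun z : X × X => f z.1 z.2) (hm : ∀ x, MemLp (f x) p P₀) :
    Measurable fun x => σ.eval (f x) x (pol.trans x) :=
  σ.measurable_trans pol (measurable_toV hp hf hm)

/-- For `φ ∈ L_p`, the risk multikernel has a measurable selector that attains
`σ(φ, x, Q(x, π(x)))` at every `x`: the lexicographic maximizer for `φ` and a dense sequence. -/
theorem exists_kernel_attaining [MeasurableSpace.CountablyGenerated X] (hp : p ≠ ∞)
    (hpq : ENNReal.HolderConjugate p q) (φ : Lp ℝ p P₀) :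
    ∃ N : Kernel X X, (∀ x, N x ∈ riskMultikernel σ pol x) ∧
      ∀ x, Integrable φ (N x) ∧ ∫ y, φ y ∂(N x) = σ.toFun φ x (pol.trans x) := by
  have : Fact (p ≠ ∞) := ⟨hp⟩
  let e : ℕ → Lp ℝ p P₀ := fun n => Nat.casesOn n φ (TopologicalSpace.denseSeq (Lp ℝ p P₀))
  have he : DenseRange e := by
    refine (TopologicalSpace.denseRange_denseSeq (Lp ℝ p P₀)).mono ?_
    rintro _ ⟨n, rfl⟩
    exact ⟨n + 1, rfl⟩
  let s : X → Lp ℝ p P₀ → ℝ := fun x ψ => σ.toFun ψ x (pol.trans x)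
  have hs : ∀ x, NatSublinear (s x) := fun x => (σ.coherent x _).natSublinear
  have hl : ∀ x, ∃ l : Lp ℝ p P₀ →L[ℝ] ℝ, ∀ ψ, l ψ = lexLimit (s x) e ψ := fun x => by
    obtain ⟨C, hC⟩ := (σ.coherent x (pol.trans x)).exists_bound
    exact (hs x).exists_clm_eq_lexLimit hC he
  choose l hl using hl
  have hle : ∀ x ψ, l x ψ ≤ s x ψ := fun x ψ => hl x ψ ▸ (hs x).lexLimit_le e ψ
  have hpos : ∀ x ψ, 0 ≤ ψ → 0 ≤ l x ψ := fun x ψ hψ => by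
    have h1 : s x (-ψ) ≤ s x 0 := (σ.coherent x _).mono _ _ (neg_nonpos.2 hψ)
    have h2 := hle x (-ψ)
    rw [(hs x).zero] at h1
    rw [map_neg] at h2
    linarith
  have hone : ∀ x, l x (Lp.const p P₀ 1) = 1 := fun x => by
    have h1 := hle x (Lp.const p P₀ 1)
    have h2 := hle x (Lp.const p P₀ (-1))
    rw [show s x (Lp.const p P₀ 1) = 1 from (σ.coherent x _).const 1] at h1
    rw [show s x (Lp.const p P₀ (-1)) = -1 from (σ.coherent x _).const (-1),
      map_neg (Lp.const p P₀), map_neg] at h2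
    linarith
  refine ⟨⟨fun x => measureOfCLM hp (l x) (hpos x), ?_⟩, fun x => ⟨?_, fun ψ => ?_⟩,
    fun x => ⟨integrable_measureOfCLM hp (l x) (hpos x) φ, ?_⟩⟩
  · refine Measure.measurable_of_measurable_coe _ fun B hB => ?_
    simp_rw [measureOfCLM_apply hp _ _ hB, hl]
    refine (measurable_lexLimit (fun ψ => ?_) e _).ennreal_ofReal
    exact σ.measurable_trans pol measurable_const
  · exact isDualProb_measureOfCLM hp (l x) (hpos x) hpq (hone x)
  · exact (integral_measureOfCLM hp (l x) (hpos x) ψ).trans_le (hle x ψ)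
  · exact (integral_measureOfCLM hp (l x) (hpos x) φ).trans
      ((hl x φ).trans ((hs x).lexLimit_first e))

end Selectors

section DynamicProgramming

variable {X 𝓤 : Type*} [MeasurableSpace X] [TopologicalSpace 𝓤] [MeasurableSpace 𝓤]
  {p q : ℝ≥0∞} {P₀ : Measure X} {w : X → ℝ}
  {𝓜 : ControlledModel X 𝓤 P₀ q} {pol : StationaryPolicy 𝓜} {h u v : X → ℝ}

/-! ### Functions of order `w` -/

lemma IsWeight.memLp_of_abs_le (hw : IsWeight p P₀ w) {f : X → ℝ} (hf : Measurable f) {a b : ℝ}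
    [IsFiniteMeasure P₀] (h : ∀ y, |f y| ≤ a + b * w y) : MemLp f p P₀ :=
  ((memLp_const a).add (hw.memLp.const_mul b)).mono' hf.aestronglyMeasurable (.of_forall h)

lemma StationaryPolicy.trans_xA : (pol.trans 𝓜.xA).1 {𝓜.xA} = 1 :=
  𝓜.Q_absorbing _ (pol.feasible _)

lemma measurableSet_ne_xA [MeasurableSingletonClass X] : MeasurableSet {x | x ≠ 𝓜.xA} :=
  (measurableSet_singleton 𝓜.xA).compl

/-- Nonnegative measurable functions of order `w` that vanish at the absorbing state: the functions
to whose iterated risks the transience condition applies. -/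
structure IsTransientBound (𝓜 : ControlledModel X 𝓤 P₀ q) (w h : X → ℝ) : Prop where
  measurable : Measurable h
  nonneg : ∀ x, 0 ≤ h x
  absorbing : h 𝓜.xA = 0
  bound : ∃ C : ℝ, 0 ≤ C ∧ ∀ x, h x ≤ C * w x

lemma IsTransientBound.memLp [IsFiniteMeasure P₀] (hh : IsTransientBound 𝓜 w h)
    (hw : IsWeight p P₀ w) : MemLp h p P₀ := by
  obtain ⟨C, -, hC⟩ := hh.bound
  exact hw.memLp_of_abs_le hh.measurable (a := 0) (b := C) fun y => by
    rw [abs_of_nonneg (hh.nonneg y), zero_add]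
    exact hC y

variable (𝓜) in
/-- Measurable `w`-bounded functions that vanish at the absorbing state: the candidate value
functions. -/
structure IsValue (w v : X → ℝ) : Prop where
  measurable : Measurable v
  wBounded : WBounded w v
  absorbing : v 𝓜.xA = 0

lemma isValue_zero : IsValue 𝓜 w 0 := ⟨measurable_zero, ⟨0, fun x => by simp⟩, rfl⟩

lemma IsValue.isTransientBound_abs_sub (hw : IsWeight p P₀ w) (hu : IsValue 𝓜 w u)
    (hv : IsValue 𝓜 w v) : IsTransientBound 𝓜 w fun y => |u y - v y| := by
  obtain ⟨A, hA⟩ := hu.wBounded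
  obtain ⟨B, hB⟩ := hv.wBounded
  refine ⟨(hu.measurable.sub hv.measurable).abs, fun x => abs_nonneg _, ?_, |A| + |B|,
    by positivity, fun x => ?_⟩
  · simp [hu.absorbing, hv.absorbing]
  · have hwx : 0 ≤ w x := zero_le_one.trans (hw.one_le x)
    have h1 := mul_le_mul_of_nonneg_right (le_abs_self A) hwx
    have h2 := mul_le_mul_of_nonneg_right (le_abs_self B) hwx
    have h3 := abs_sub (u x) (v x)
    linarith [hA x, hB x]

lemma exists_abs_cost_add_le [TopologicalSpace X] (hw : IsWeight p P₀ w) (hc : 𝓜.G3 w)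
    (hv : WBounded w v) :
    ∃ A B : ℝ, 0 ≤ A ∧ 0 ≤ B ∧
      ∀ x y, |𝓜.c x (pol.rule x) y + v y| ≤ A * w x + B * w y := by
  obtain ⟨A, hA, hcA⟩ := hc.wBounded
  obtain ⟨C, hC⟩ := hv
  refine ⟨A, |A + C|, hA.le, abs_nonneg _, fun x y => ?_⟩
  have h1 := hcA x _ (pol.feasible x) y
  have h2 := le_abs_self (A + C)
  have h3 := (abs_add_le (𝓜.c x (pol.rule x) y) (v y)).trans (add_le_add h1 (hC y))
  have h4 := mul_le_mul_of_nonneg_right h2 (zero_le_one.trans (hw.one_le y))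
  linarith

lemma measurable_cost [TopologicalSpace X] (hc : 𝓜.G3 w) :
    Measurable fun z : X × X => 𝓜.c z.1 (pol.rule z.1) z.2 :=
  hc.measurable.comp (measurable_fst.prodMk
    ((pol.measurable_rule.comp measurable_fst).prodMk measurable_snd))

lemma memLp_cost_add [TopologicalSpace X] [IsFiniteMeasure P₀] (hc : 𝓜.G3 w)
    (hw : IsWeight p P₀ w) (hvm : Measurable v) (hv : WBounded w v) (x : X) :
    MemLp (fun y => 𝓜.c x (pol.rule x) y + v y) p P₀ := by
  obtain ⟨A, B, -, -, h⟩ := exists_abs_cost_add_le (pol := pol) hw hc hv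
  exact hw.memLp_of_abs_le
    (((measurable_cost hc).comp (measurable_const.prodMk measurable_id)).add hvm) (h x)

/-! ### Iterates of the one-step risk -/

lemma isSelector_multiPowSum_one {Y : Type*} [MeasurableSpace Y] {𝔐 : Y → Set (Measure Y)}
    {N : Kernel Y Y} (hN : IsSelector N 𝔐) : IsSelector N (multiPowSum 𝔐 1) :=
  fun x => ⟨0, rfl, N x, hN x, (zero_add _).symm⟩

variable [IsProbabilityMeasure P₀] [Fact (1 ≤ p)]

/-- The one-step risk operator `(S h)(x) = σ(h, x, Q(x, π(x)))`. -/
def riskOp (σ : RiskTransitionMapping p q P₀) (pol : StationaryPolicy 𝓜) (h : X → ℝ) (x : X) : ℝ :=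
  σ.eval h x (pol.trans x)

variable {σ : RiskTransitionMapping p q P₀}

/-- Risk-transience as a uniform bound of order `w` on the integrals of functions of order `w` with
respect to the selectors of the sums of powers of the effective multikernel. -/
lemma RiskTransient.exists_lintegral_le (htrans : RiskTransient σ pol w) (hw : IsWeight p P₀ w) :
    ∃ K : ℝ, 0 ≤ K ∧ ∀ (T : ℕ) (M : Kernel {x // x ≠ 𝓜.xA} {x // x ≠ 𝓜.xA}),
      IsSelector M (multiPowSum (effMultikernel σ pol) T) →
      ∀ (h : X → ℝ) (C : ℝ), 0 ≤ C → (∀ x, h x ≤ C * w x) →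
      ∀ x, ∫⁻ y, ENNReal.ofReal (h y) ∂(M x) ≤ ENNReal.ofReal (C * K * w x) := by
  obtain ⟨K, hK⟩ := htrans
  refine ⟨max K 0, le_max_right _ _, fun T M hM h C hC hle x => ?_⟩
  have hwx : 0 < w x := zero_lt_one.trans_le (hw.one_le x)
  have h1 : ∫⁻ y, ENNReal.ofReal (w y) ∂(M x) ≤
      ENNReal.ofReal (max K 0) * ENNReal.ofReal (w x) := by
    rw [← ENNReal.div_le_iff (ENNReal.ofReal_pos.2 hwx).ne' ENNReal.ofReal_ne_top]
    exact (le_iSup (fun x : {x // x ≠ 𝓜.xA} => (∫⁻ y, ENNReal.ofReal (w y) ∂(M x)) /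
      ENNReal.ofReal (w x)) x).trans ((hK T M hM).trans
        (ENNReal.ofReal_le_ofReal (le_max_left _ _)))
  calc ∫⁻ y, ENNReal.ofReal (h y) ∂(M x)
      ≤ ∫⁻ y, ENNReal.ofReal C * ENNReal.ofReal (w y) ∂(M x) := lintegral_mono fun y => by
        rw [← ENNReal.ofReal_mul hC]
        exact ENNReal.ofReal_le_ofReal (hle y)
    _ = ENNReal.ofReal C * ∫⁻ y, ENNReal.ofReal (w y) ∂(M x) :=
        lintegral_const_mul' _ _ ENNReal.ofReal_ne_top
    _ ≤ ENNReal.ofReal C * (ENNReal.ofReal (max K 0) * ENNReal.ofReal (w x)) := by gcongr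
    _ = ENNReal.ofReal (C * max K 0 * w x) := by
        rw [← ENNReal.ofReal_mul (le_max_right _ _), ← ENNReal.ofReal_mul hC, mul_assoc]

lemma riskOp_nonneg (hh : IsTransientBound 𝓜 w h) (hw : IsWeight p P₀ w) (x : X) :
    0 ≤ riskOp σ pol h x :=
  (σ.eval_const x (pol.trans x) 0).symm.trans_le
    (σ.eval_mono x _ (memLp_const 0) (hh.memLp hw) hh.nonneg)

variable [MeasurableSingletonClass X]

lemma riskOp_xA (hσ : σ.LawInvariant) {f : X → ℝ} (hf : MemLp f p P₀) :
    riskOp σ pol f 𝓜.xA = f 𝓜.xA :=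
  σ.eval_of_singleton _ _ hσ pol.trans_xA hf

variable [MeasurableSpace.CountablyGenerated X]

/-- The one-step risk of `h` is the integral of `h` with respect to a measurable selector of the
effective multikernel. -/
lemma IsTransientBound.exists_selector (hh : IsTransientBound 𝓜 w h) (hw : IsWeight p P₀ w)
    (hp : p ≠ ∞) (hpq : ENNReal.HolderConjugate p q) :
    ∃ N : Kernel {x // x ≠ 𝓜.xA} {x // x ≠ 𝓜.xA}, IsSelector N (effMultikernel σ pol) ∧
      ∀ x, ∫⁻ y, ENNReal.ofReal (h y) ∂(N x) = ENNReal.ofReal (riskOp σ pol h x) := by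
  have hm := hh.memLp hw
  obtain ⟨N, hN, hint⟩ := exists_kernel_attaining pol σ hp hpq (toV p P₀ h)
  have hS : MeasurableSet {x | x ≠ 𝓜.xA} := measurableSet_ne_xA
  refine ⟨(N.comapRight (MeasurableEmbedding.subtype_coe hS)).comap Subtype.val
    measurable_subtype_coe, fun x => ⟨N x, hN x, ?_⟩, fun x => ?_⟩
  · rw [Kernel.comap_apply, Kernel.comapRight_apply]
    rfl
  · have hae : toV p P₀ h =ᵐ[N x] h := by
      rw [toV_of_memLp hm]
      exact (hN x).1.2.1.ae_eq hm.coeFn_toLp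
    have h1 : ∫⁻ y, ENNReal.ofReal (h y) ∂(N x) = ENNReal.ofReal (riskOp σ pol h x) := by
      rw [← ofReal_integral_eq_lintegral_ofReal ((hint x).1.congr hae) (.of_forall hh.nonneg),
        ← integral_congr_ae hae, (hint x).2]
      rfl
    rw [Kernel.comap_apply, Kernel.comapRight_apply, ← h1]
    refine (lintegral_subtype_comap hS fun y => ENNReal.ofReal (h y)).trans ?_
    rw [← lintegral_indicator hS]
    refine lintegral_congr fun y => ?_
    by_cases hy : y = 𝓜.xA
    · simp [hy, hh.absorbing]
    · simp [hy]

lemma IsTransientBound.riskOp (hh : IsTransientBound 𝓜 w h) (hw : IsWeight p P₀ w)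
    (hp : p ≠ ∞) (hpq : ENNReal.HolderConjugate p q) (hσ : σ.LawInvariant)
    (htrans : RiskTransient σ pol w) : IsTransientBound 𝓜 w (RiskMDP.riskOp σ pol h) := by
  have hA : RiskMDP.riskOp σ pol h 𝓜.xA = 0 := (riskOp_xA hσ (hh.memLp hw)).trans hh.absorbing
  refine ⟨σ.measurable_eval_trans pol hp (f := fun _ => h) (hh.measurable.comp measurable_snd)
    fun _ => hh.memLp hw, riskOp_nonneg hh hw, hA, ?_⟩
  obtain ⟨C, hC0, hC⟩ := hh.bound
  obtain ⟨K, hK0, hK⟩ := htrans.exists_lintegral_le hw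
  obtain ⟨N, hN, hint⟩ := hh.exists_selector (σ := σ) (pol := pol) hw hp hpq
  refine ⟨C * K, by positivity, fun x => ?_⟩
  have hwx : 0 ≤ w x := zero_le_one.trans (hw.one_le x)
  by_cases hx : x = 𝓜.xA
  · subst hx
    rw [hA]
    positivity
  · have h1 := hK 1 N (isSelector_multiPowSum_one hN) h C hC0 hC ⟨x, hx⟩
    rw [hint] at h1
    exact (ENNReal.ofReal_le_ofReal_iff (by positivity)).1 h1

lemma IsTransientBound.iterate (hh : IsTransientBound 𝓜 w h) (hw : IsWeight p P₀ w)
    (hp : p ≠ ∞) (hpq : ENNReal.HolderConjugate p q) (hσ : σ.LawInvariant)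
    (htrans : RiskTransient σ pol w) (n : ℕ) :
    IsTransientBound 𝓜 w ((RiskMDP.riskOp σ pol)^[n] h) := by
  induction n with
  | zero => exact hh
  | succ n ih =>
    rw [Function.iterate_succ_apply']
    exact ih.riskOp hw hp hpq hσ htrans

/-- The `(n + 1)`-fold iterated risk is the integral with respect to a selector of the
`(n + 1)`-st power of the effective multikernel. -/
lemma IsTransientBound.exists_selector_multiPow (hh : IsTransientBound 𝓜 w h)
    (hw : IsWeight p P₀ w) (hp : p ≠ ∞) (hpq : ENNReal.HolderConjugate p q)
    (hσ : σ.LawInvariant) (htrans : RiskTransient σ pol w) (n : ℕ) :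
    ∃ N : Kernel {x // x ≠ 𝓜.xA} {x // x ≠ 𝓜.xA},
      IsSelector N (multiPow (effMultikernel σ pol) n) ∧
      ∀ x, ∫⁻ y, ENNReal.ofReal (h y) ∂(N x) =
        ENNReal.ofReal ((RiskMDP.riskOp σ pol)^[n + 1] h x) := by
  induction n generalizing h with
  | zero => exact hh.exists_selector hw hp hpq
  | succ n ih =>
    obtain ⟨M, hM, hMint⟩ := ih (hh.riskOp (pol := pol) hw hp hpq hσ htrans)
    obtain ⟨N, hN, hNint⟩ := hh.exists_selector (σ := σ) (pol := pol) hw hp hpq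
    refine ⟨N ∘ₖ M, fun x => ⟨M, N, hM, hN, rfl⟩, fun x => ?_⟩
    have hm : Measurable fun y : {x // x ≠ 𝓜.xA} => ENNReal.ofReal (h y) :=
      (hh.measurable.comp measurable_subtype_coe).ennreal_ofReal
    rw [Kernel.lintegral_comp _ _ _ hm, Function.iterate_succ_apply, ← hMint]
    simp_rw [hNint]

lemma IsTransientBound.exists_selector_multiPowSum (hh : IsTransientBound 𝓜 w h)
    (hw : IsWeight p P₀ w) (hp : p ≠ ∞) (hpq : ENNReal.HolderConjugate p q)
    (hσ : σ.LawInvariant) (htrans : RiskTransient σ pol w) (T : ℕ) :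
    ∃ N : Kernel {x // x ≠ 𝓜.xA} {x // x ≠ 𝓜.xA},
      IsSelector N (multiPowSum (effMultikernel σ pol) T) ∧
      ∀ x, ∫⁻ y, ENNReal.ofReal (h y) ∂(N x) =
        ENNReal.ofReal (∑ n ∈ Finset.range T, (RiskMDP.riskOp σ pol)^[n + 1] h x) := by
  induction T with
  | zero => exact ⟨0, fun x => rfl, fun x => by simp⟩
  | succ T ih =>
    obtain ⟨M, hM, hMint⟩ := ih
    obtain ⟨N, hN, hNint⟩ := hh.exists_selector_multiPow (pol := pol) hw hp hpq hσ htrans T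
    refine ⟨M + N, fun x => ⟨M x, hM x, N x, hN x, rfl⟩, fun x => ?_⟩
    have hit := fun n => (hh.iterate (pol := pol) hw hp hpq hσ htrans n).nonneg x
    rw [add_apply, lintegral_add_measure, hMint, hNint, Finset.sum_range_succ,
      ENNReal.ofReal_add (Finset.sum_nonneg fun n _ => hit _) (hit _)]

/-- Transience makes the series of iterated risks converge, with a bound of order `w`. -/
lemma IsTransientBound.exists_sum_le (hh : IsTransientBound 𝓜 w h) (hw : IsWeight p P₀ w)
    (hp : p ≠ ∞) (hpq : ENNReal.HolderConjugate p q) (hσ : σ.LawInvariant)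
    (htrans : RiskTransient σ pol w) :
    ∃ C : ℝ, ∀ T x, ∑ n ∈ Finset.range T, (RiskMDP.riskOp σ pol)^[n] h x ≤ C * w x := by
  obtain ⟨C, hC0, hC⟩ := hh.bound
  obtain ⟨K, hK0, hK⟩ := htrans.exists_lintegral_le hw
  refine ⟨C + C * K, fun T x => ?_⟩
  have hwx : 0 ≤ w x := zero_le_one.trans (hw.one_le x)
  have hit := fun n => hh.iterate (pol := pol) hw hp hpq hσ htrans n
  have h1 : ∑ n ∈ Finset.range T, (RiskMDP.riskOp σ pol)^[n + 1] h x ≤ C * K * w x := by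
    by_cases hx : x = 𝓜.xA
    · subst hx
      rw [Finset.sum_eq_zero fun n _ => (hit (n + 1)).absorbing]
      positivity
    · obtain ⟨N, hN, hint⟩ :=
        hh.exists_selector_multiPowSum (pol := pol) hw hp hpq hσ htrans T
      have h1 := hK T N hN h C hC0 hC ⟨x, hx⟩
      rw [hint] at h1
      exact (ENNReal.ofReal_le_ofReal_iff (by positivity)).1 h1
  calc ∑ n ∈ Finset.range T, (RiskMDP.riskOp σ pol)^[n] h x
      ≤ ∑ n ∈ Finset.range (T + 1), (RiskMDP.riskOp σ pol)^[n] h x := by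
        rw [Finset.sum_range_succ]
        exact le_add_of_nonneg_right ((hit T).nonneg x)
    _ = ∑ n ∈ Finset.range T, (RiskMDP.riskOp σ pol)^[n + 1] h x + h x := by
        rw [Finset.sum_range_succ']
        rfl
    _ ≤ _ := by linarith [hC x]

lemma IsTransientBound.summable_iterate (hh : IsTransientBound 𝓜 w h) (hw : IsWeight p P₀ w)
    (hp : p ≠ ∞) (hpq : ENNReal.HolderConjugate p q) (hσ : σ.LawInvariant)
    (htrans : RiskTransient σ pol w) (x : X) :
    Summable fun n => (RiskMDP.riskOp σ pol)^[n] h x := by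
  obtain ⟨C, hC⟩ := hh.exists_sum_le hw hp hpq hσ htrans
  exact summable_of_sum_range_le
    (fun n => (hh.iterate hw hp hpq hσ htrans n).nonneg x) fun T => hC T x

/-- The weight `w` itself does not vanish at the absorbing state; it is split into its restriction
to the effective state space and a constant. -/
lemma exists_riskOp_weight_le (hw : IsWeight p P₀ w) (hp : p ≠ ∞)
    (hpq : ENNReal.HolderConjugate p q) (hσ : σ.LawInvariant) (htrans : RiskTransient σ pol w) :
    ∃ C : ℝ, ∀ x, riskOp σ pol w x ≤ C * w x := by
  have hw0 : ∀ x, 0 ≤ w x := fun x => zero_le_one.trans (hw.one_le x)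
  have hh : IsTransientBound 𝓜 w ({x | x ≠ 𝓜.xA}.indicator w) := by
    refine ⟨hw.measurable.indicator measurableSet_ne_xA,
      fun x => Set.indicator_nonneg (fun y _ => hw0 y) x, by simp, 1, zero_le_one, fun x => ?_⟩
    rw [one_mul]
    exact Set.indicator_le_self' (fun y _ => hw0 y) x
  obtain ⟨C, -, hC⟩ := (hh.riskOp (pol := pol) hw hp hpq hσ htrans).bound
  refine ⟨C + w 𝓜.xA, fun x => ?_⟩
  have hm := hh.memLp hw
  have h1 : riskOp σ pol w x ≤ riskOp σ pol ({x | x ≠ 𝓜.xA}.indicator w) x + w 𝓜.xA := by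
    refine (σ.eval_mono x _ hw.memLp (hm.add (memLp_const (w 𝓜.xA))) fun y => ?_).trans
      ((σ.eval_add_le x _ hm (memLp_const (w 𝓜.xA))).trans_eq ?_)
    · by_cases hy : y = 𝓜.xA
      · simp [hy]
      · simp [hy, hw0]
    · rw [σ.eval_const]
      rfl
  have h2 : w 𝓜.xA ≤ w 𝓜.xA * w x := le_mul_of_one_le_right (hw0 _) (hw.one_le x)
  linarith [hC x]

/-! ### Value iteration -/

variable [TopologicalSpace X]

/-- The policy evaluation operator `(D v)(x) = σ(c(x, π(x), ·) + v, x, Q(x, π(x)))`. -/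
def evalOp (σ : RiskTransitionMapping p q P₀) (pol : StationaryPolicy 𝓜) (v : X → ℝ) (x : X) : ℝ :=
  σ.eval (fun y => 𝓜.c x (pol.rule x) y + v y) x (pol.trans x)

omit [MeasurableSingletonClass X] in
lemma measurable_evalOp (hc : 𝓜.G3 w) (hw : IsWeight p P₀ w) (hp : p ≠ ∞)
    (hvm : Measurable v) (hv : WBounded w v) : Measurable (evalOp σ pol v) :=
  σ.measurable_eval_trans pol hp (f := fun x y => 𝓜.c x (pol.rule x) y + v y)
    ((measurable_cost hc).add (hvm.comp measurable_snd)) fun x => memLp_cost_add hc hw hvm hv x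

lemma wBounded_evalOp (hc : 𝓜.G3 w) (hw : IsWeight p P₀ w) (hp : p ≠ ∞)
    (hpq : ENNReal.HolderConjugate p q) (hσ : σ.LawInvariant) (htrans : RiskTransient σ pol w)
    (hvm : Measurable v) (hv : WBounded w v) : WBounded w (evalOp σ pol v) := by
  obtain ⟨A, B, hA, hB, h⟩ := exists_abs_cost_add_le (pol := pol) hw hc hv
  obtain ⟨C, hC⟩ := exists_riskOp_weight_le hw hp hpq hσ htrans
  refine ⟨A + B * C, fun x => ?_⟩
  have hm := memLp_cost_add (pol := pol) hc hw hvm hv x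
  have h1 := σ.abs_eval_sub_le x (pol.trans x) hm (memLp_const (0 : ℝ))
  rw [σ.eval_const, sub_zero] at h1
  simp only [sub_zero] at h1
  have hBw : MemLp (fun y => B * w y) p P₀ := hw.memLp.const_mul B
  have h2 := σ.eval_mono x (pol.trans x) hm.abs ((memLp_const (A * w x)).add hBw) (h x)
  have h3 := σ.eval_add_le x (pol.trans x) (memLp_const (A * w x)) hBw
  rw [σ.eval_const, σ.eval_const_mul x _ hw.memLp hB] at h3
  have h4 := mul_le_mul_of_nonneg_left (hC x) hB
  calc |evalOp σ pol v x| ≤ _ := h1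
    _ ≤ _ := h2
    _ ≤ _ := h3
    _ ≤ A * w x + B * (C * w x) := by linarith! [h4]
    _ = _ := by ring

omit [MeasurableSingletonClass X] [MeasurableSpace.CountablyGenerated X] in
lemma abs_evalOp_sub_le (hc : 𝓜.G3 w) (hw : IsWeight p P₀ w)
    (hum : Measurable u) (hu : WBounded w u) (hvm : Measurable v) (hv : WBounded w v) (x : X) :
    |evalOp σ pol u x - evalOp σ pol v x| ≤ riskOp σ pol (fun y => |u y - v y|) x := by
  have := σ.abs_eval_sub_le x (pol.trans x) (memLp_cost_add (pol := pol) hc hw hum hu x)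
    (memLp_cost_add (pol := pol) hc hw hvm hv x)
  simpa only [add_sub_add_left_eq_sub] using! this

omit [MeasurableSpace.CountablyGenerated X] in
lemma evalOp_xA (hc : 𝓜.G3 w) (hw : IsWeight p P₀ w) (hσ : σ.LawInvariant)
    (hvm : Measurable v) (hv : WBounded w v) : evalOp σ pol v 𝓜.xA = v 𝓜.xA := by
  rw [evalOp, σ.eval_of_singleton _ _ hσ pol.trans_xA (memLp_cost_add hc hw hvm hv _),
    𝓜.c_absorbing _ (pol.feasible _), zero_add]

lemma IsValue.evalOp (hc : 𝓜.G3 w) (hw : IsWeight p P₀ w) (hp : p ≠ ∞)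
    (hpq : ENNReal.HolderConjugate p q) (hσ : σ.LawInvariant) (htrans : RiskTransient σ pol w)
    (hv : IsValue 𝓜 w v) : IsValue 𝓜 w (RiskMDP.evalOp σ pol v) :=
  ⟨measurable_evalOp hc hw hp hv.measurable hv.wBounded,
    wBounded_evalOp hc hw hp hpq hσ htrans hv.measurable hv.wBounded,
    (evalOp_xA hc hw hσ hv.measurable hv.wBounded).trans hv.absorbing⟩

lemma IsValue.iterate (hc : 𝓜.G3 w) (hw : IsWeight p P₀ w) (hp : p ≠ ∞)
    (hpq : ENNReal.HolderConjugate p q) (hσ : σ.LawInvariant) (htrans : RiskTransient σ pol w)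
    (hv : IsValue 𝓜 w v) (n : ℕ) : IsValue 𝓜 w ((RiskMDP.evalOp σ pol)^[n] v) := by
  induction n with
  | zero => exact hv
  | succ n ih =>
    rw [Function.iterate_succ_apply']
    exact ih.evalOp hc hw hp hpq hσ htrans

/-- The distance between two value iterations is dominated by the iterated risk of the initial
distance. -/
lemma IsValue.abs_iterate_sub_le (hc : 𝓜.G3 w) (hw : IsWeight p P₀ w) (hp : p ≠ ∞)
    (hpq : ENNReal.HolderConjugate p q) (hσ : σ.LawInvariant) (htrans : RiskTransient σ pol w)
    (hu : IsValue 𝓜 w u) (hv : IsValue 𝓜 w v) (n : ℕ) (x : X) :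
    |(RiskMDP.evalOp σ pol)^[n] u x - (RiskMDP.evalOp σ pol)^[n] v x| ≤
      (riskOp σ pol)^[n] (fun y => |u y - v y|) x := by
  induction n generalizing x with
  | zero => exact le_rfl
  | succ n ih =>
    have hun := hu.iterate (pol := pol) hc hw hp hpq hσ htrans n
    have hvn := hv.iterate (pol := pol) hc hw hp hpq hσ htrans n
    simp only [Function.iterate_succ_apply']
    refine (abs_evalOp_sub_le hc hw hun.measurable hun.wBounded hvn.measurable
      hvn.wBounded x).trans ?_
    exact σ.eval_mono x _ ((hun.isTransientBound_abs_sub hw hvn).memLp hw)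
      (((hu.isTransientBound_abs_sub hw hv).iterate hw hp hpq hσ htrans n).memLp hw) ih

/-- Value iteration from `0` converges to a fixed point of the policy evaluation operator. -/
theorem exists_tendsto_iterate_evalOp (hc : 𝓜.G3 w) (hw : IsWeight p P₀ w) (hp : p ≠ ∞)
    (hpq : ENNReal.HolderConjugate p q) (hσ : σ.LawInvariant) (htrans : RiskTransient σ pol w) :
    ∃ V : X → ℝ, IsValue 𝓜 w V ∧ evalOp σ pol V = V ∧
      ∀ x, Tendsto (fun n => (evalOp σ pol)^[n] 0 x) atTop (𝓝 (V x)) := by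
  set D := evalOp σ pol
  have hval := fun n => (isValue_zero (𝓜 := 𝓜) (w := w)).iterate (pol := pol) hc hw hp hpq hσ
    htrans n
  have hh := (hval 1).isTransientBound_abs_sub hw isValue_zero
  set h : X → ℝ := fun y => |D^[1] 0 y - (0 : X → ℝ) y|
  have hstep : ∀ x n, dist (D^[n] 0 x) (D^[n + 1] 0 x) ≤ (riskOp σ pol)^[n] h x := fun x n => by
    rw [dist_comm, Real.dist_eq]
    exact (hval 1).abs_iterate_sub_le hc hw hp hpq hσ htrans isValue_zero n x
  have hsum := fun x => hh.summable_iterate (pol := pol) hw hp hpq hσ htrans x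
  choose V hV using fun x =>
    cauchySeq_tendsto_of_complete (cauchySeq_of_dist_le_of_summable _ (hstep x) (hsum x))
  obtain ⟨C, hC⟩ := hh.exists_sum_le (pol := pol) hw hp hpq hσ htrans
  have hbd : ∀ n x, |D^[n] 0 x| ≤ C * w x := fun n x => by
    have h1 := dist_le_range_sum_of_dist_le (f := fun n => D^[n] 0 x) n
      (d := fun n => (riskOp σ pol)^[n] h x) fun _ => hstep x _
    rw [dist_comm, Real.dist_eq] at h1
    have h2 : |D^[n] 0 x - 0| ≤ _ := h1
    rw [sub_zero] at h2
    exact h2.trans (hC n x)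
  have hVbd : ∀ x, |V x| ≤ C * w x := fun x => le_of_tendsto' (hV x).abs fun n => hbd n x
  have hVm : Measurable V := measurable_of_tendsto_metrizable (fun n => (hval n).measurable)
    (tendsto_pi_nhds.2 hV)
  have hVA : V 𝓜.xA = 0 := tendsto_nhds_unique (hV 𝓜.xA)
    (tendsto_const_nhds.congr fun n => ((hval n).absorbing).symm)
  refine ⟨V, ⟨hVm, ⟨C, hVbd⟩, hVA⟩, funext fun x => ?_, hV⟩
  have h1 : Tendsto (fun n => D (D^[n] 0) x) atTop (𝓝 (D V x)) := by
    refine σ.tendsto_eval x (pol.trans x) hp (G := fun y => 2 * C * w y)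
      (fun n => memLp_cost_add hc hw (hval n).measurable (hval n).wBounded x)
      (memLp_cost_add hc hw hVm ⟨C, hVbd⟩ x) (hw.memLp.const_mul _) (fun n y => ?_)
      fun y => (hV y).const_add _
    rw [add_sub_add_left_eq_sub]
    have := abs_sub (D^[n] 0 y) (V y)
    linarith [hbd n y, hVbd y]
  refine tendsto_nhds_unique h1 (((hV x).comp (tendsto_add_atTop_nat 1)).congr fun n => ?_)
  rw [Function.comp_apply, Function.iterate_succ_apply']

/-- Uniqueness of the fixed point.  A solution in `L_p` need not be measurable a priori, but the
right hand side of the equation depends only on its class in `L_p`. -/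
theorem eq_of_evalOp_eq (hc : 𝓜.G3 w) (hw : IsWeight p P₀ w) (hp : p ≠ ∞)
    (hpq : ENNReal.HolderConjugate p q) (hσ : σ.LawInvariant) (htrans : RiskTransient σ pol w)
    {V : X → ℝ} (hV : IsValue 𝓜 w V) (hVfix : evalOp σ pol V = V)
    (hvp : MemLp v p P₀) (hv : WBounded w v) (hvA : v 𝓜.xA = 0)
    (hvfix : ∀ x, x ≠ 𝓜.xA → v x = evalOp σ pol v x) : v = V := by
  have hcx : ∀ x, MemLp (fun y => 𝓜.c x (pol.rule x) y) p P₀ := fun x => by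
    have h0 : IsValue 𝓜 w 0 := isValue_zero
    simpa using memLp_cost_add (pol := pol) hc hw h0.measurable h0.wBounded x
  have hvm : Measurable v := by
    let v' := hvp.1.mk v
    have hae : v =ᵐ[P₀] v' := hvp.1.ae_eq_mk
    have hv'm : Measurable v' := hvp.1.stronglyMeasurable_mk.measurable
    have hv'p : MemLp v' p P₀ := (memLp_congr_ae hae).1 hvp
    have h1 : Measurable fun x => σ.eval (fun y => 𝓜.c x (pol.rule x) y + v' y) x (pol.trans x) :=
      σ.measurable_eval_trans pol hp (f := fun x y => 𝓜.c x (pol.rule x) y + v' y)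
        ((measurable_cost hc).add (hv'm.comp measurable_snd)) fun x => (hcx x).add hv'p
    have h2 := h1.indicator (measurableSet_ne_xA (𝓜 := 𝓜))
    convert h2 using 1
    funext x
    by_cases hx : x = 𝓜.xA
    · simp [hx, hvA]
    · rw [Set.indicator_of_mem (show x ∈ {x | x ≠ 𝓜.xA} from hx), hvfix x hx, evalOp,
        RiskTransitionMapping.eval, RiskTransitionMapping.eval]
      congr 1
      exact toV_congr (by filter_upwards [hae] with y hy; rw [hy])
  have hval : IsValue 𝓜 w v := ⟨hvm, hv, hvA⟩
  have hfix : evalOp σ pol v = v := funext fun x => by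
    by_cases hx : x = 𝓜.xA
    · rw [hx, evalOp_xA hc hw hσ hvm hv]
    · exact (hvfix x hx).symm
  funext x
  have h1 := fun n => hval.abs_iterate_sub_le hc hw hp hpq hσ htrans hV n x
  simp only [Function.iterate_fixed hfix, Function.iterate_fixed hVfix] at h1
  have h2 := ge_of_tendsto'
    ((hval.isTransientBound_abs_sub hw hV).summable_iterate hw hp hpq hσ htrans
      x).tendsto_atTop_zero h1
  exact sub_eq_zero.1 (abs_nonpos_iff.1 h2)

end DynamicProgramming

/-! ### Nested conditional risks along the controlled process -/

section Nested

variable {X : Type*} [MeasurableSpace X]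

instance (κ : Kernel X X) [IsMarkovKernel κ] (x₁ : X) : IsProbabilityMeasure (pathLaw κ x₁) := by
  unfold pathLaw
  infer_instance

lemma ae_pathLaw_zero [MeasurableSingletonClass X] (κ : Kernel X X) [IsMarkovKernel κ] (x₁ : X) :
    ∀ᵐ ω ∂(pathLaw κ x₁), ω 0 = x₁ := by
  have hmap : (pathLaw κ x₁).map (Preorder.frestrictLe 0) = Measure.dirac fun _ => x₁ := by
    rw [pathLaw, Kernel.traj_map_frestrictLe_apply, Kernel.partialTraj_self, Kernel.id_apply]
  have h : ∀ᵐ z ∂((pathLaw κ x₁).map (Preorder.frestrictLe 0)),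
      z ⟨0, Finset.mem_Iic.2 le_rfl⟩ = x₁ := by
    rw [hmap]
    have hm : Measurable fun z : Finset.Iic 0 → X => z ⟨0, Finset.mem_Iic.2 le_rfl⟩ :=
      measurable_pi_apply _
    exact (ae_dirac_iff (hm (measurableSet_singleton x₁))).2 rfl
  exact ae_of_ae_map (Preorder.measurable_frestrictLe 0).aemeasurable h

/-- A random variable that depends on the initial state only and agrees almost surely with `f` at
the initial state has the value `f x₁` at the constant path `x₁`. -/
lemma apply_const_of_ae_eq [MeasurableSingletonClass X] {κ : Kernel X X} [IsMarkovKernel κ]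
    {x₁ : X} {F : (ℕ → X) → ℝ} {f : X → ℝ}
    (hF : Measurable[Filtration.piLE (X := fun _ : ℕ => X) 0] F)
    (h : F =ᵐ[pathLaw κ x₁] fun ω => f (ω 0)) : F (fun _ => x₁) = f x₁ := by
  obtain ⟨ω, h1, h2⟩ := (h.and (ae_pathLaw_zero κ x₁)).exists
  have h3 : F (fun _ => x₁) = F ω := by
    refine hF.factorsThrough (funext fun i => ?_)
    obtain ⟨i, hi⟩ := i
    obtain rfl : i = 0 := Nat.le_zero.1 hi
    exact h2.symm
  exact (h3.trans h1).trans (congrArg f h2)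

variable {𝓤 : Type*} [TopologicalSpace 𝓤] [MeasurableSpace 𝓤]
  {p q : ℝ≥0∞} {P₀ : Measure X} [IsProbabilityMeasure P₀] [Fact (1 ≤ p)]
  {σ : RiskTransitionMapping p q P₀} {𝓜 : ControlledModel X 𝓤 P₀ q} {pol : StationaryPolicy 𝓜}
  {w : X → ℝ} [MeasurableSingletonClass X] [MeasurableSpace.CountablyGenerated X]
  [TopologicalSpace X]

/-- Under a Markov risk measure, the nested risk of the next `n` costs is the `n`-th value iterate
at the current state. -/
lemma MarkovRiskMeasure.nested_ae_eq (hc : 𝓜.G3 w) (hw : IsWeight p P₀ w) (hp : p ≠ ∞)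
    (hpq : ENNReal.HolderConjugate p q) (hσ : σ.LawInvariant) (htrans : RiskTransient σ pol w)
    {x₁ : X} (R : MarkovRiskMeasure σ pol w x₁) (n t : ℕ) :
    (R.nested (fun t => ⟨fun ω => 𝓜.c (ω t) (pol.rule (ω t)) (ω (t + 1)),
      R.cost_mem 𝓜.c hc.measurable hc.wBounded t⟩) n t).1
      =ᵐ[pathLaw pol.kernel x₁] fun ω => (evalOp σ pol)^[n] 0 (ω t) := by
  induction n generalizing t with
  | zero => exact .rfl
  | succ n ih =>
    have hv : IsValue 𝓜 w ((evalOp σ pol)^[n] 0) :=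
      isValue_zero.iterate hc hw hp hpq hσ htrans n
    set v := (evalOp σ pol)^[n] 0
    have hgm : Measurable fun z : X × 𝓤 × X => 𝓜.c z.1 z.2.1 z.2.2 + v z.2.2 :=
      hc.measurable.add (hv.measurable.comp (measurable_snd.comp measurable_snd))
    have hgb : 𝓜.CostWBounded w fun x u y => 𝓜.c x u y + v y := by
      obtain ⟨A, hA, hcA⟩ := hc.wBounded
      obtain ⟨B, hB⟩ := hv.wBounded
      refine ⟨A + |B|, by positivity, fun x u hu y => ?_⟩
      have h1 := mul_le_mul_of_nonneg_right (le_abs_self B) (zero_le_one.trans (hw.one_le y))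
      have h2 := mul_nonneg (abs_nonneg B) (zero_le_one.trans (hw.one_le x))
      have h3 := abs_add_le (𝓜.c x u y) (v y)
      linarith [hcA x u hu y, hB y]
    have hmarkov := R.markov _ hgm hgb t
    have hsum : (⟨fun ω => 𝓜.c (ω t) (pol.rule (ω t)) (ω (t + 1)),
        R.cost_mem 𝓜.c hc.measurable hc.wBounded t⟩ + R.nested
          (fun t => ⟨fun ω => 𝓜.c (ω t) (pol.rule (ω t)) (ω (t + 1)),
            R.cost_mem 𝓜.c hc.measurable hc.wBounded t⟩) n (t + 1) : R.Z (t + 1)).1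
        =ᵐ[pathLaw pol.kernel x₁]
          fun ω => 𝓜.c (ω t) (pol.rule (ω t)) (ω (t + 1)) + v (ω (t + 1)) := by
      filter_upwards [ih (t + 1)] with ω hω
      exact congrArg (𝓜.c (ω t) (pol.rule (ω t)) (ω (t + 1)) + ·) hω
    -- The conditional risk depends only on the almost sure class of its argument.
    have hle := R.mono t _ ⟨_, R.cost_mem _ hgm hgb t⟩ hsum.le
    have hge := R.mono t ⟨_, R.cost_mem _ hgm hgb t⟩ _ hsum.symm.le
    filter_upwards [hle, hge, hmarkov] with ω h1 h2 h3
    rw [Function.iterate_succ_apply']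
    exact (le_antisymm h1 h2).trans h3

lemma J_eq_iterate (hc : 𝓜.G3 w) (hw : IsWeight p P₀ w) (hp : p ≠ ∞)
    (hpq : ENNReal.HolderConjugate p q) (hσ : σ.LawInvariant) (htrans : RiskTransient σ pol w)
    (ρ : ∀ x₁ : X, MarkovRiskMeasure σ pol w x₁) (T : ℕ) (x : X) :
    J ρ hc T x = (evalOp σ pol)^[T] 0 x :=
  apply_const_of_ae_eq ((ρ x).measurable_of_mem 0 _ (Subtype.prop _))
    ((ρ x).nested_ae_eq hc hw hp hpq hσ htrans T 0)

end Nested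

end RiskMDP

end

/-- Policy evaluation for a risk-transient model. A separable metrizable space whose Borel
`σ`-algebra is standard is the same as a Borel subset of a Polish space, up to homeomorphism. -/
theorem theoremt
    {X : Type*} [TopologicalSpace X] [TopologicalSpace.MetrizableSpace X]
    [SecondCountableTopology X] [MeasurableSpace X] [BorelSpace X] [StandardBorelSpace X]
    {𝓤 : Type*} [TopologicalSpace 𝓤] [TopologicalSpace.MetrizableSpace 𝓤]
    [SecondCountableTopology 𝓤] [MeasurableSpace 𝓤] [BorelSpace 𝓤] [StandardBorelSpace 𝓤]
    (p q : ℝ≥0∞) [Fact (1 ≤ p)] (hp : p ≠ ∞) (hpq : ENNReal.HolderConjugate p q)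
    (P₀ : Measure X) [IsProbabilityMeasure P₀]
    (σ : RiskMDP.RiskTransitionMapping p q P₀) (hσ : σ.LawInvariant)
    (𝓜 : RiskMDP.ControlledModel X 𝓤 P₀ q) (pol : RiskMDP.StationaryPolicy 𝓜)
    (w : X → ℝ) (hw : RiskMDP.IsWeight p P₀ w)
    (htrans : RiskMDP.RiskTransient σ pol w) (hc : 𝓜.G3 w)
    (ρ : ∀ x₁ : X, RiskMDP.MarkovRiskMeasure σ pol w x₁) :
    (∀ x, Tendsto (fun T => RiskMDP.J ρ hc T x) atTop (𝓝 (RiskMDP.Jinf ρ hc x))) ∧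
    MemLp (RiskMDP.Jinf ρ hc) p P₀ ∧ RiskMDP.WBounded w (RiskMDP.Jinf ρ hc) ∧
    ∀ v : X → ℝ, MemLp v p P₀ → RiskMDP.WBounded w v →
      (((∀ x, x ≠ 𝓜.xA →
          v x = σ.eval (fun y => 𝓜.c x (pol.rule x) y + v y) x (pol.trans x)) ∧ v 𝓜.xA = 0) ↔
        ∀ x, v x = RiskMDP.Jinf ρ hc x) := by
  obtain ⟨V, hV, hfix, hlim⟩ :=
    RiskMDP.exists_tendsto_iterate_evalOp hc hw hp hpq hσ htrans
  have hJ : ∀ x, Tendsto (fun T => RiskMDP.J ρ hc T x) atTop (𝓝 (V x)) := fun x =>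
    (hlim x).congr fun T => (RiskMDP.J_eq_iterate hc hw hp hpq hσ htrans ρ T x).symm
  have hJV : RiskMDP.Jinf ρ hc = V := funext fun x => (hJ x).limUnder_eq
  rw [hJV]
  obtain ⟨C, hC⟩ := hV.wBounded
  refine ⟨hJ, hw.memLp_of_abs_le hV.measurable (a := 0) (b := C) fun y => by simpa using hC y,
    hV.wBounded, fun v hvp hv => ⟨fun h x => ?_, fun h => ?_⟩⟩
  · rw [RiskMDP.eq_of_evalOp_eq hc hw hp hpq hσ htrans hV hfix hvp hv h.2 h.1]
  · obtain rfl : v = V := funext h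
    exact ⟨fun x _ => (congrFun hfix x).symm, hV.absorbing⟩
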